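/- Let $d \ge 4$ be an integer, let $R = \mathbf Q[a_0,\dots,a_d]$ with its standard grading, and let $F = \sum_{i=0}^d \binom{d}{i} a_i x_1^{d-i} x_2^i$ be the generic binary form of order $d$. For $1 \le k \le \lfloor d/2 \rfloor$ let \[ H_{2k} = (F,F)_{2k} = \left(\frac{(d-2k)!}{d!}\right)^2 \sum_{i=0}^{2k} (-1)^i \binom{2k}{i} \frac{\partial^{2k} F}{\partial x_1^{2k-i}\,\partial x_2^{i}} \, \frac{\partial^{2k} F}{\partial x_1^{i}\,\partial x_2^{2k-i}} \] be the $2k$-th transvectant of $F$ with itself. For $1 \le q \le \lfloor d/2 \rfloor$ let $J_{2q} \subseteq R$ be the ideal generated by all the coefficients (with respect to the monomials in $x_1,x_2$) of $H_2, H_4, \dots, H_{2q}$, and write $(J_{2q})_t$ for its homogeneous part of degree $t$. For $1 \le q \le \lfloor d/2 \rfloor - 1$ define \[ \alpha_q = \min\,\{\, m \ge 0 : (J_{2q})_t = (J_{2q+2})_t \ \text{ for all } t \ge m \,\}; \] this minimum exists. **Theorem 2.** Let $(q,b,N)$ be any of the triples $(1,3,6)$, $(1,4,8)$, $(2,3,12)$,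 $(3,3,16)$. Then $\alpha_q > b$ for all $d \ge N$. -/

import Mathlib

open MvPolynomial

noncomputable section

namespace RNC

/-- The polynomial ring `R = ℚ[a_0, …, a_d]`. -/
abbrev CoeffRing (d : ℕ) : Type := MvPolynomial (Fin (d + 1)) ℚ

/-- The `r`-th transvectant `(A, B)_r` of two binary forms `A`, `B` of orders `p`, `q` in the
variables `x_1 = X 0`, `x_2 = X 1`, with coefficients in a commutative `ℚ`-algebra. It is zero
for `r > min p q`. -/
def transvectant {K : Type*} [CommRing K] [Algebra ℚ K] (p q r : ℕ)
    (A B : MvPolynomial (Fin 2) K) : MvPolynomial (Fin 2) K :=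
  if r ≤ min p q then
    (((p - r).factorial * (q - r).factorial : ℚ) / (p.factorial * q.factorial : ℚ)) •
      ∑ i ∈ Finset.range (r + 1), ((-1 : ℚ) ^ i * (r.choose i : ℚ)) •
        (((pderiv 0)^[r - i] ((pderiv 1)^[i] A)) * ((pderiv 0)^[i] ((pderiv 1)^[r - i] B)))
  else 0

/-- The generic binary `d`-ic `F = ∑ i, (d choose i) a_i x_1 ^ (d - i) x_2 ^ i`. -/
def genericForm (d : ℕ) : MvPolynomial (Fin 2) (CoeffRing d) :=
  ∑ i : Fin (d + 1),
    (d.choose i : ℚ) • (C (X i : CoeffRing d) * X 0 ^ (d - (i : ℕ)) * X 1 ^ (i : ℕ))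

/-- The quadratic covariant `H_{2k} = (F, F)_{2k}` of the generic binary `d`-ic. -/
def quadCovariant (d k : ℕ) : MvPolynomial (Fin 2) (CoeffRing d) :=
  transvectant d d (2 * k) (genericForm d) (genericForm d)

/-- The space `W_{2q}` spanned by all the coefficients (with respect to the monomials in
`x_1, x_2`) of `H_2, H_4, …, H_{2q}`. -/
def coeffSpan (d q : ℕ) : Submodule ℚ (CoeffRing d) :=
  Submodule.span ℚ {c | ∃ k, 1 ≤ k ∧ k ≤ q ∧ ∃ s : Fin 2 →₀ ℕ, c = coeff s (quadCovariant d k)}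

/-- The ideal `J_{2q}` of `ℚ[a_0, …, a_d]` generated by `W_{2q}`. -/
def filtrationIdeal (d q : ℕ) : Ideal (CoeffRing d) :=
  Ideal.span (coeffSpan d q : Set (CoeffRing d))

/-- The degree `t` part of an ideal of `ℚ[a_0, …, a_d]`: its elements that are homogeneous of
degree `t`. -/
def gradedPart {d : ℕ} (I : Ideal (CoeffRing d)) (t : ℕ) : Submodule ℚ (CoeffRing d) :=
  I.restrictScalars ℚ ⊓ homogeneousSubmodule (Fin (d + 1)) ℚ t

/-- The term `α_q = min {m : (J_{2q})_t = (J_{2q+2})_t for all t ≥ m}` of the saturation sequence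
of `d`, meant for `1 ≤ q ≤ ⌊d/2⌋ - 1`. The infimum of the empty set is `0` in `ℕ`, so a
positive lower bound on `α_q` contains the claim that the minimum exists. -/
def saturationTerm (d q : ℕ) : ℕ :=
  sInf {m : ℕ | ∀ t, m ≤ t →
    gradedPart (filtrationIdeal d q) t = gradedPart (filtrationIdeal d (q + 1)) t}

end RNC

end

/-! The derivations `raise` and `lower` let sl₂ act on R. The coefficients of each H_{2k} form one
string: `lower` kills the first, and `raise` produces the others from it up to nonzero factors. The
apolar `pairing`, scaled so that a_i has square norm 1/C(d,i), is positive definite and makes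
`raise` and `lower` adjoint. So if P is killed by `lower` and orthogonal to all multiples of the
first coefficients of H_2, …, H_{2q}, it is orthogonal to J_{2q}; if also P ≠ 0, then P is not in
J_{2q} (`notMem_filtrationIdeal`). Only multiples with the degree and weight of P need testing
(`pairing_mul_genQuad_zero`), and P is chosen of such weight that hardly any remain.

Three choices of P in J_{2q+2} suffice. For d ≥ 4(q+1), the leading coefficient of (F, H_{2q+2})_e
with e the largest even number ≤ d: no test remains (`three_lt_saturationTerm`). For q = 1, d ≥ 6, d
≠ 7, a combination of the full-order transvectants of H_2 and of H_4 with themselves: two tests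
remain, invariance makes them proportional, and two independent invariants can satisfy one linear
condition (`four_lt_saturationTerm_one`). For q = 1, d = 7, a combination of the leading
coefficients of (F, H_2)_4 and (F, H_4)_2, with one test (`three_lt_saturationTerm_seven`).

A bound on the infimum also requires that J_{2q} and J_{2q+2} agree in large degrees
(`exists_gradedPart_eq`). This holds because a form with zero Hessian and invertible a_0 is a
multiple of a power of a linear form, on which all H_{2k} vanish; stability under `raise` carries
the conclusion from a_0 to every a_i. -/

noncomputable section

namespace RNC

/-! ### Transvectants under raising and lowering derivations -/

section Transvectant

variable {S T : Type*} [CommRing S] [CommRing T]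

/-- The form of order `m` with coefficients `u l, u (l + 1), …`, dehomogenised. -/
def rowPoly (u : ℕ → S) (m l : ℕ) : Polynomial S :=
  ∑ p ∈ Finset.range (m + 1), Polynomial.monomial p ((m.choose p : S) * u (p + l))

/-- The `r`-th transvectant with itself, dehomogenised and unnormalised, of the binary form of
order `m + r` with coefficients `u`. -/
def quadPoly (u : ℕ → S) (m r : ℕ) : Polynomial S :=
  ∑ l ∈ Finset.range (r + 1),
    Polynomial.C ((-1 : S) ^ l * (r.choose l : S)) * (rowPoly u m l * rowPoly u m (r - l))

/-- The coefficients of `quadPoly`. -/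
def quadCoeff (u : ℕ → S) (m r n : ℕ) : S := (quadPoly u m r).coeff n

lemma cast_choose_succ (m n : ℕ) :
    (m.choose (n + 1) : S) * ((n : S) + 1) = (m.choose n : S) * ((m : S) - n) := by
  rcases le_or_gt n m with hn | hn
  · have := congrArg (Nat.cast : ℕ → S) (Nat.choose_succ_right_eq m n)
    push_cast [Nat.cast_sub hn] at this
    exact this
  · rw [Nat.choose_eq_zero_of_lt hn, Nat.choose_eq_zero_of_lt (by omega)]; simp

lemma coeff_rowPoly (u : ℕ → S) (m l n : ℕ) :
    (rowPoly u m l).coeff n = (m.choose n : S) * u (n + l) := by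
  simp only [rowPoly, Polynomial.finsetSum_coeff, Polynomial.coeff_monomial,
    Finset.sum_ite_eq', Finset.mem_range]
  split_ifs with h
  · rfl
  · rw [Nat.choose_eq_zero_of_lt (by omega)]; simp

lemma natDegree_rowPoly_le (u : ℕ → S) (m l : ℕ) : (rowPoly u m l).natDegree ≤ m := by
  rw [Polynomial.natDegree_le_iff_coeff_eq_zero]
  intro n hn
  rw [coeff_rowPoly, Nat.choose_eq_zero_of_lt hn]; simp

lemma quadCoeff_eq (u : ℕ → S) (m r n : ℕ) :
    quadCoeff u m r n = ∑ l ∈ Finset.range (r + 1), (-1 : S) ^ l * (r.choose l : S) *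
      ∑ x ∈ Finset.HasAntidiagonal.antidiagonal n,
        ((m.choose x.1 : S) * u (x.1 + l)) * ((m.choose x.2 : S) * u (x.2 + (r - l))) := by
  simp only [quadCoeff, quadPoly, Polynomial.finsetSum_coeff, Polynomial.coeff_C_mul]
  simp only [Polynomial.coeff_mul, coeff_rowPoly]

lemma quadCoeff_eq_zero (u : ℕ → S) (m r n : ℕ) (h : 2 * m < n) : quadCoeff u m r n = 0 := by
  rw [quadCoeff_eq]
  refine Finset.sum_eq_zero fun l _ => ?_
  rw [Finset.sum_eq_zero, mul_zero]
  intro x hx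
  rw [Finset.HasAntidiagonal.mem_antidiagonal] at hx
  rcases lt_or_ge m x.1 with h1 | h1
  · rw [Nat.choose_eq_zero_of_lt h1]; simp
  · rw [Nat.choose_eq_zero_of_lt (show m < x.2 by omega)]; simp

lemma map_quadCoeff (φ : S →+* T) (u : ℕ → S) (m r n : ℕ) :
    φ (quadCoeff u m r n) = quadCoeff (fun i => φ (u i)) m r n := by
  simp [quadCoeff_eq, map_sum]

/-- The coefficients of `p'` are the images under `δ` of those of `p`. -/
def CoeffwiseImage (δ : Derivation ℤ S S) (p p' : Polynomial S) : Prop :=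
  ∀ n, δ (p.coeff n) = p'.coeff n

lemma CoeffwiseImage.mul {δ : Derivation ℤ S S} {p p' q q' : Polynomial S}
    (hp : CoeffwiseImage δ p p') (hq : CoeffwiseImage δ q q') :
    CoeffwiseImage δ (p * q) (p' * q + p * q') := by
  intro n
  simp only [Polynomial.coeff_add, Polynomial.coeff_mul, map_sum, Derivation.leibniz,
    ← Finset.sum_add_distrib]
  refine Finset.sum_congr rfl fun x _ => ?_
  rw [hp, hq]; simp only [smul_eq_mul]; ring

lemma derivation_sign_choose (δ : Derivation ℤ S S) (r l : ℕ) :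
    δ ((-1 : S) ^ l * (r.choose l : S)) = 0 := by
  have : ((-1 : S) ^ l * (r.choose l : S)) = (((-1) ^ l * (r.choose l : ℤ) : ℤ) : S) := by
    push_cast; rfl
  rw [this, Derivation.map_intCast]

lemma CoeffwiseImage.quadPoly {δ : Derivation ℤ S S} {u : ℕ → S} {m r : ℕ}
    {p' : ℕ → Polynomial S} (h : ∀ l ≤ r, CoeffwiseImage δ (rowPoly u m l) (p' l)) :
    CoeffwiseImage δ (quadPoly u m r) (∑ l ∈ Finset.range (r + 1),
      Polynomial.C ((-1 : S) ^ l * (r.choose l : S)) *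
        (p' l * rowPoly u m (r - l) + rowPoly u m l * p' (r - l))) := by
  intro n
  simp only [RNC.quadPoly, Polynomial.finsetSum_coeff, Polynomial.coeff_C_mul, map_sum]
  refine Finset.sum_congr rfl fun l hl => ?_
  rw [Derivation.leibniz, derivation_sign_choose]
  rw [Finset.mem_range] at hl
  rw [(h l (by omega)).mul (h (r - l) (by omega)) n]
  simp

/-- The alternating binomial sum that appears when a derivation acts on a transvectant. -/
lemma alternating_sum_eq_zero (f : ℕ → ℕ → S) (r : ℕ) :
    ∑ l ∈ Finset.range (r + 1), (-1 : S) ^ l * (r.choose l : S) *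
      (((r - l : ℕ) : S) * f (l + 1) (r - l) + (l : S) * f l (r - l + 1)) = 0 := by
  simp only [mul_add, Finset.sum_add_distrib]
  -- The last term of the first sum and the initial term of the second vanish. After an index shift
  -- the rest cancels by C(r,l)(r-l) = C(r,l+1)(l+1).
  rw [Finset.sum_range_succ]
  rw [Finset.sum_range_succ' (fun l => (-1 : S) ^ l * (r.choose l : S) *
    ((l : S) * f l (r - l + 1)))]
  simp only [Nat.sub_self, Nat.cast_zero, zero_mul, mul_zero, add_zero]
  rw [← Finset.sum_add_distrib]
  refine Finset.sum_eq_zero fun l hl => ?_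
  rw [Finset.mem_range] at hl
  have h1 : r - (l + 1) + 1 = r - l := by omega
  have h2 : ((r.choose l : ℕ) : S) * ((r - l : ℕ) : S) =
      (r.choose (l + 1) : S) * ((l + 1 : ℕ) : S) := by
    rw [Nat.cast_sub (by omega), ← cast_choose_succ]; push_cast; ring
  rw [h1, pow_succ]
  linear_combination (-1 : S) ^ l * f (l + 1) (r - l) * h2

/-- A raising derivation maps the `n`-th coefficient of a transvectant to `n + 1` times the
next one. -/
lemma raise_quadCoeff {δ : Derivation ℤ S S} {u : ℕ → S} {m r : ℕ}
    (h : ∀ i, δ (u i) = (((m + r : ℕ) : S) - i) * u (i + 1)) (n : ℕ) :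
    δ (quadCoeff u m r n) = ((n + 1 : ℕ) : S) * quadCoeff u m r (n + 1) := by
  have hrow : ∀ l ≤ r, CoeffwiseImage δ (rowPoly u m l)
      (Polynomial.derivative (rowPoly u m l) +
        Polynomial.C ((r - l : ℕ) : S) * rowPoly u m (l + 1)) := by
    intro l hl n
    simp only [Polynomial.coeff_add, Polynomial.coeff_derivative, Polynomial.coeff_C_mul,
      coeff_rowPoly, Derivation.leibniz, Derivation.map_natCast, h, smul_eq_mul, mul_zero]
    have e := cast_choose_succ (S := S) m n
    rw [show n + 1 + l = n + l + 1 by ring, show n + (l + 1) = n + l + 1 by ring,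
      Nat.cast_sub hl]
    push_cast
    linear_combination -u (n + l + 1) * e
  have key := CoeffwiseImage.quadPoly hrow n
  unfold quadCoeff
  rw [key]
  -- The derivatives of the rows add up to the derivative of the product; the shifted rows form the
  -- vanishing alternating sum.
  have : (∑ l ∈ Finset.range (r + 1), Polynomial.C ((-1 : S) ^ l * (r.choose l : S)) *
      ((Polynomial.derivative (rowPoly u m l) +
        Polynomial.C ((r - l : ℕ) : S) * rowPoly u m (l + 1)) * rowPoly u m (r - l) +
      rowPoly u m l * (Polynomial.derivative (rowPoly u m (r - l)) +
        Polynomial.C ((r - (r - l) : ℕ) : S) * rowPoly u m (r - l + 1)))) =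
      Polynomial.derivative (quadPoly u m r) := by
    have h0 := alternating_sum_eq_zero (fun i j => rowPoly u m i * rowPoly u m j) r
    rw [← add_zero (Polynomial.derivative (quadPoly u m r)), ← h0, quadPoly,
      Polynomial.derivative_sum, ← Finset.sum_add_distrib]
    refine Finset.sum_congr rfl fun l hl => ?_
    rw [Finset.mem_range] at hl
    rw [Polynomial.derivative_C_mul, Polynomial.derivative_mul, Nat.sub_sub_self (by omega)]
    simp only [map_mul, map_pow, map_neg, map_one, map_natCast]
    ring
  rw [this, Polynomial.coeff_derivative]
  push_cast; ring

/-- The polynomial whose coefficients are the images of those of a transvectant under a lowering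
derivation. -/
lemma lower_quadPoly {δ : Derivation ℤ S S} {u : ℕ → S} {m r : ℕ}
    (h : ∀ i ≤ m + r, δ (u i) = (i : S) * u (i - 1)) :
    CoeffwiseImage δ (quadPoly u m r)
      (Polynomial.C ((2 * m : ℕ) : S) * (quadPoly u m r * Polynomial.X) -
        Polynomial.derivative (quadPoly u m r) * Polynomial.X ^ 2) := by
  have hrow : ∀ l ≤ r, CoeffwiseImage δ (rowPoly u m l)
      (Polynomial.C (m : S) * (rowPoly u m l * Polynomial.X) -
        Polynomial.derivative (rowPoly u m l) * Polynomial.X ^ 2 +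
        Polynomial.C (l : S) * rowPoly u m (l - 1)) := by
    intro l hl n
    have h1 : δ ((m.choose n : S) * u (n + l)) =
        (m.choose n : S) * (((n + l : ℕ) : S) * u (n + l - 1)) := by
      rw [Derivation.leibniz, Derivation.map_natCast]
      rcases le_or_gt n m with hn | hn
      · rw [h _ (by omega)]; simp
      · rw [Nat.choose_eq_zero_of_lt hn]; simp
    simp only [Polynomial.coeff_add, Polynomial.coeff_sub, Polynomial.coeff_C_mul, coeff_rowPoly]
    rw [h1]
    have h3 : (l : S) * u (n + (l - 1)) = (l : S) * u (n + l - 1) := by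
      rcases l with _ | l
      · simp
      · rfl
    rcases n with _ | n
    · have e0 : (Polynomial.derivative (rowPoly u m l) * Polynomial.X ^ 2).coeff 0 = 0 := by
        simp [Polynomial.coeff_zero_eq_eval_zero]
      rw [e0]
      simp only [zero_add]
      simp only [Polynomial.coeff_mul_X_zero, mul_zero]
      ring
    · have e1 : (Polynomial.derivative (rowPoly u m l) * Polynomial.X ^ 2).coeff (n + 1) =
          (n : S) * ((m.choose n : S) * u (n + l)) := by
        rcases n with _ | n
        · rw [pow_two, ← mul_assoc, Polynomial.coeff_mul_X]; simp
        · rw [Polynomial.coeff_mul_X_pow, Polynomial.coeff_derivative, coeff_rowPoly]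
          push_cast; ring
      rw [e1, Polynomial.coeff_mul_X, coeff_rowPoly]
      have e := cast_choose_succ (S := S) m n
      have h4 : n + 1 + l - 1 = n + l := by omega
      rw [h4] at h3 ⊢
      push_cast
      linear_combination u (n + l) * e - (m.choose (n + 1) : S) * h3
  have key := CoeffwiseImage.quadPoly hrow
  convert key using 1
  -- Lowering decreases the row index, so the alternating sum is applied to reflected indices.
  have h0 := alternating_sum_eq_zero (fun i j => rowPoly u m (r - i) * rowPoly u m (r - j)) r
  rw [← add_zero (_ - _), ← h0, quadPoly, Polynomial.derivative_sum, Finset.sum_mul,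
    Finset.sum_mul, Finset.mul_sum, ← Finset.sum_sub_distrib, ← Finset.sum_add_distrib]
  refine Finset.sum_congr rfl fun l hl => ?_
  rw [Finset.mem_range] at hl
  rw [Polynomial.derivative_C_mul, Polynomial.derivative_mul, Nat.sub_sub_self (by omega)]
  have h5 : (l : Polynomial S) * rowPoly u m (r - (r - l + 1)) = l * rowPoly u m (l - 1) := by
    rw [show r - (r - l + 1) = l - 1 by omega]
  rw [show r - (l + 1) = r - l - 1 by omega]
  simp only [map_mul, map_pow, map_neg, map_one, map_natCast]
  push_cast
  linear_combination (-1) ^ l * (r.choose l : Polynomial S) * rowPoly u m (r - l) * h5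

lemma lower_quadCoeff_zero {δ : Derivation ℤ S S} {u : ℕ → S} {m r : ℕ}
    (h : ∀ i ≤ m + r, δ (u i) = (i : S) * u (i - 1)) : δ (quadCoeff u m r 0) = 0 := by
  rw [quadCoeff, lower_quadPoly h 0]
  simp [Polynomial.coeff_zero_eq_eval_zero]

lemma lower_quadCoeff_succ {δ : Derivation ℤ S S} {u : ℕ → S} {m r : ℕ}
    (h : ∀ i ≤ m + r, δ (u i) = (i : S) * u (i - 1)) (n : ℕ) :
    δ (quadCoeff u m r (n + 1)) = (((2 * m : ℕ) : S) - n) * quadCoeff u m r n := by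
  rw [quadCoeff, lower_quadPoly h (n + 1), Polynomial.coeff_sub, Polynomial.coeff_C_mul,
    Polynomial.coeff_mul_X]
  have e1 : (Polynomial.derivative (quadPoly u m r) * Polynomial.X ^ 2).coeff (n + 1) =
      (n : S) * (quadPoly u m r).coeff n := by
    rcases n with _ | n
    · rw [pow_two, ← mul_assoc, Polynomial.coeff_mul_X]; simp
    · rw [Polynomial.coeff_mul_X_pow, Polynomial.coeff_derivative]
      push_cast; ring
  rw [e1, quadCoeff]; ring

/-- The leading coefficient, up to a factor, of the `e`-th transvectant of two binary forms of
orders `M` and `N` with coefficients `α` and `β`. -/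
def leadTransvectant (M N e : ℕ) (α β : ℕ → S) : S :=
  ∑ j ∈ Finset.range (e + 1),
    (-1 : S) ^ j * ((M - e + j).factorial * (N - j).factorial : ℕ) * (α (e - j) * β j)

/-- The factorial weights are those for which the Leibniz terms cancel in consecutive pairs:
lowering α in term j meets lowering β in term j + 1 with opposite sign. -/
lemma lower_leadTransvectant {δ : Derivation ℤ S S} {M N e : ℕ} {α β : ℕ → S}
    (hM : e ≤ M) (hN : e ≤ N)
    (hα0 : δ (α 0) = 0) (hα : ∀ n < M, δ (α (n + 1)) = ((M : S) - n) * α n)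
    (hβ0 : δ (β 0) = 0) (hβ : ∀ n < N, δ (β (n + 1)) = ((N : S) - n) * β n) :
    δ (leadTransvectant M N e α β) = 0 := by
  have hδ : ∀ (j c : ℕ) (x : S), δ ((-1 : S) ^ j * (c : S) * x) = (-1 : S) ^ j * (c : S) * δ x := by
    intro j c x
    have : (-1 : S) ^ j * (c : S) = (((-1) ^ j * (c : ℤ) : ℤ) : S) := by push_cast; rfl
    rw [this, Derivation.leibniz, Derivation.map_intCast]; simp
  simp only [leadTransvectant, map_sum, hδ, Derivation.leibniz, smul_eq_mul, mul_add,
    Finset.sum_add_distrib]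
  rw [Finset.sum_range_succ', Finset.sum_range_succ (n := e)]
  simp only [hβ0, hα0, Nat.sub_self, mul_zero, add_zero]
  rw [← Finset.sum_add_distrib]
  refine Finset.sum_eq_zero fun j hj => ?_
  rw [Finset.mem_range] at hj
  obtain ⟨i, rfl⟩ : ∃ i, e = i + j + 1 := ⟨e - j - 1, by omega⟩
  obtain ⟨M', rfl⟩ : ∃ M', M = i + j + 1 + M' := ⟨M - (i + j + 1), by omega⟩
  obtain ⟨N', rfl⟩ : ∃ N', N = j + 1 + N' := ⟨N - (j + 1), by omega⟩
  rw [show i + j + 1 - (j + 1) = i by omega, show i + j + 1 - j = i + 1 by omega,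
    hα i (by omega), hβ j (by omega), show i + j + 1 + M' - (i + j + 1) = M' by omega,
    show j + 1 + N' - (j + 1) = N' by omega, show j + 1 + N' - j = N' + 1 by omega,
    show M' + (j + 1) = M' + j + 1 by ring, Nat.factorial_succ, Nat.factorial_succ N', pow_succ]
  push_cast
  ring

/-- The transvectant of full order `N` of two forms of order `N` is also killed by a raising
derivation. -/
lemma raise_leadTransvectant {δ : Derivation ℤ S S} {N : ℕ} {α β : ℕ → S}
    (hα0 : δ (α N) = 0) (hα : ∀ n < N, δ (α n) = ((n + 1 : ℕ) : S) * α (n + 1))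
    (hβ0 : δ (β N) = 0) (hβ : ∀ n < N, δ (β n) = ((n + 1 : ℕ) : S) * β (n + 1)) :
    δ (leadTransvectant N N N α β) = 0 := by
  -- Reading coefficients backwards (exchanging x_1 and x_2) turns raising into lowering; exchanging
  -- α and β as well leaves the full-order sum unchanged.
  have h := lower_leadTransvectant (δ := δ) (M := N) (N := N) (e := N)
    (α := fun n => β (N - n)) (β := fun n => α (N - n)) le_rfl le_rfl (by simpa using hβ0) ?_
    (by simpa using hα0) ?_
  · have e : leadTransvectant N N N (fun n => β (N - n)) (fun n => α (N - n)) =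
        leadTransvectant N N N α β := by
      refine Finset.sum_congr rfl fun j hj => ?_
      rw [Finset.mem_range] at hj
      simp only
      rw [Nat.sub_sub_self (by omega)]; ring
    rwa [e] at h
  all_goals
    intro n hn
    first
    | rw [hα _ (by omega)]
    | rw [hβ _ (by omega)]
    rw [show N - (n + 1) + 1 = N - n by omega, Nat.cast_sub hn.le]

end Transvectant

/-! ### The action of sl₂ on the generic coefficients -/

/-- The coefficient `a_i` of the generic form, extended by `0` to `i > d`. -/
def genCoeff (d i : ℕ) : CoeffRing d := if h : i < d + 1 then X ⟨i, h⟩ else 0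

lemma genCoeff_val {d : ℕ} (i : Fin (d + 1)) : genCoeff d i = X i := by
  rw [genCoeff, dif_pos i.isLt]

lemma genCoeff_of_le {d i : ℕ} (h : i ≤ d) : genCoeff d i = X ⟨i, Nat.lt_succ_of_le h⟩ := by
  simp [genCoeff, Nat.lt_succ_of_le h]

lemma genCoeff_of_gt {d i : ℕ} (h : d < i) : genCoeff d i = 0 := by
  simp [genCoeff]; omega

/-- The derivation `a_i ↦ (d - i) a_{i+1}`. -/
def raise (d : ℕ) : Derivation ℚ (CoeffRing d) (CoeffRing d) :=
  mkDerivation ℚ fun i => ((d : CoeffRing d) - ((i : ℕ) : CoeffRing d)) * genCoeff d (i + 1)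

/-- The derivation `a_i ↦ i a_{i-1}`. -/
def lower (d : ℕ) : Derivation ℚ (CoeffRing d) (CoeffRing d) :=
  mkDerivation ℚ fun i => ((i : ℕ) : CoeffRing d) * genCoeff d (i - 1)

lemma raise_genCoeff (d i : ℕ) :
    raise d (genCoeff d i) = ((d : CoeffRing d) - (i : CoeffRing d)) * genCoeff d (i + 1) := by
  rcases le_or_gt i d with h | h
  · rw [genCoeff_of_le h, raise, mkDerivation_X]
  · rw [genCoeff_of_gt h, genCoeff_of_gt (by omega)]; simp

lemma lower_genCoeff {d i : ℕ} (h : i ≤ d) :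
    lower d (genCoeff d i) = (i : CoeffRing d) * genCoeff d (i - 1) := by
  rw [genCoeff_of_le h, lower, mkDerivation_X]

/-- The coefficient of `x_1 ^ (2 d - 2 r - n) x_2 ^ n` in the `r`-th transvectant of the generic
form with itself, for `r ≤ d`. -/
abbrev genQuad (d r n : ℕ) : CoeffRing d := quadCoeff (genCoeff d) (d - r) r n

lemma raise_genQuad {d r : ℕ} (h : r ≤ d) (n : ℕ) :
    raise d (genQuad d r n) = ((n + 1 : ℕ) : CoeffRing d) * genQuad d r (n + 1) :=
  raise_quadCoeff (δ := (raise d).restrictScalars ℤ)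
    (fun i => by rw [Nat.sub_add_cancel h]; exact raise_genCoeff d i) n

lemma lower_genQuad_zero {d r : ℕ} (h : r ≤ d) : lower d (genQuad d r 0) = 0 :=
  lower_quadCoeff_zero (δ := (lower d).restrictScalars ℤ)
    (fun i hi => lower_genCoeff (by omega))

lemma lower_genQuad_succ {d r : ℕ} (h : r ≤ d) (n : ℕ) :
    lower d (genQuad d r (n + 1)) =
      (((2 * (d - r) : ℕ) : CoeffRing d) - n) * genQuad d r n :=
  lower_quadCoeff_succ (δ := (lower d).restrictScalars ℤ)
    (fun i hi => lower_genCoeff (by omega)) n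

/-! ### The apolar inner product -/

section Pairing

variable {σ : Type*} (c : σ → ℚ)

/-- The square norm of a monomial under `pairing`. -/
def monomialWeight (s : σ →₀ ℕ) : ℚ := s.prod fun i k => (k.factorial : ℚ) * c i ^ k

/-- The symmetric bilinear form on polynomials under which distinct monomials are orthogonal and
multiplication by `X i` is adjoint to `c i • ∂ / ∂ X i`. -/
def pairing : MvPolynomial σ ℚ →ₗ[ℚ] MvPolynomial σ ℚ →ₗ[ℚ] ℚ :=
  (basisMonomials σ ℚ).constr ℚ fun s => monomialWeight c s • lcoeff ℚ s

lemma pairing_monomial (s : σ →₀ ℕ) (x : ℚ) (Q : MvPolynomial σ ℚ) :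
    pairing c (monomial s x) Q = x * (monomialWeight c s * coeff s Q) := by
  have h : monomial s x = x • (basisMonomials σ ℚ) s := by
    simp [smul_monomial]
  rw [h, map_smul, pairing, Module.Basis.constr_basis]
  simp

lemma pairing_eq_sum (P Q : MvPolynomial σ ℚ) :
    pairing c P Q = ∑ s ∈ P.support, coeff s P * (monomialWeight c s * coeff s Q) := by
  conv_lhs => rw [P.as_sum, map_sum, LinearMap.sum_apply]
  exact Finset.sum_congr rfl fun s _ => pairing_monomial c s _ Q

lemma pairing_comm (P Q : MvPolynomial σ ℚ) : pairing c P Q = pairing c Q P := by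
  classical
  induction P using MvPolynomial.induction_on' with
  | add p q hp hq => simp [hp, hq]
  | monomial s x =>
    induction Q using MvPolynomial.induction_on' with
    | add p q hp hq => simp [hp, hq]
    | monomial t y =>
      rw [pairing_monomial, pairing_monomial, coeff_monomial, coeff_monomial]
      by_cases h : s = t
      · subst h; simp; ring
      · simp [h, Ne.symm h]

lemma monomialWeight_add_single (s : σ →₀ ℕ) (i : σ) :
    monomialWeight c (s + Finsupp.single i 1) = monomialWeight c s * (c i * (s i + 1)) := by
  classical
  have key : ∀ t : σ →₀ ℕ, monomialWeight c t =
      ((t i).factorial : ℚ) * c i ^ (t i) * monomialWeight c (t.erase i) := by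
    intro t
    rw [monomialWeight, monomialWeight, Finsupp.mul_prod_erase' t i
      (fun i k => (k.factorial : ℚ) * c i ^ k) (by simp)]
  rw [key, key s, Finsupp.erase_add, Finsupp.erase_single, add_zero]
  simp [Nat.factorial_succ, pow_succ]
  ring

lemma pairing_X_mul (i : σ) (P Q : MvPolynomial σ ℚ) :
    pairing c (X i * P) Q = c i * pairing c P (pderiv i Q) := by
  induction P using MvPolynomial.induction_on' with
  | add p q hp hq => simp [mul_add, hp, hq]
  | monomial s x =>
    rw [mul_comm, X, monomial_mul, pairing_monomial, pairing_monomial, coeff_pderiv,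
      monomialWeight_add_single]
    ring

lemma pairing_mul_X (i : σ) (P Q : MvPolynomial σ ℚ) :
    pairing c P (X i * Q) = c i * pairing c (pderiv i P) Q := by
  rw [pairing_comm, pairing_X_mul, pairing_comm]

lemma monomialWeight_pos (hc : ∀ i, 0 < c i) (s : σ →₀ ℕ) : 0 < monomialWeight c s :=
  Finset.prod_pos fun i _ => mul_pos (by positivity) (pow_pos (hc i) _)

lemma eq_zero_of_pairing_self (hc : ∀ i, 0 < c i) {P : MvPolynomial σ ℚ}
    (h : pairing c P P = 0) : P = 0 := by
  rw [pairing_eq_sum, Finset.sum_eq_zero_iff_of_nonneg] at h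
  · by_contra hP
    obtain ⟨s, hs⟩ := Finset.nonempty_of_ne_empty (mt support_eq_empty.mp hP)
    have h1 := h s hs
    have h2 := monomialWeight_pos c hc s
    rw [mem_support_iff] at hs
    simp [hs, h2.ne'] at h1
  · intro s _
    have h2 := monomialWeight_pos c hc s
    nlinarith [mul_nonneg h2.le (mul_self_nonneg (coeff s P))]

lemma pairing_eq_zero_of_isWeightedHomogeneous {M : Type*} [AddCommMonoid M] {w : σ → M}
    {P Q : MvPolynomial σ ℚ} {m n : M} (hP : IsWeightedHomogeneous w P m)
    (hQ : IsWeightedHomogeneous w Q n) (hmn : m ≠ n) : pairing c P Q = 0 := by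
  rw [pairing_eq_sum]
  refine Finset.sum_eq_zero fun s hs => ?_
  rw [mem_support_iff] at hs
  rw [hQ.coeff_eq_zero s (by rw [hP hs]; exact hmn)]
  simp

end Pairing

/-- The normalisation of `pairing` under which `raise` and `lower` are adjoint. -/
def invChoose (d : ℕ) (i : Fin (d + 1)) : ℚ := ((d.choose i : ℕ) : ℚ)⁻¹

lemma invChoose_pos (d : ℕ) (i : Fin (d + 1)) : 0 < invChoose d i := by
  have : 0 < d.choose i := Nat.choose_pos (by omega)
  rw [invChoose]; positivity

lemma derivation_sum_apply {ι R : Type*} [CommRing R] [Algebra ℚ R] (s : Finset ι)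
    (δ : ι → Derivation ℚ R R) (x : R) : (∑ i ∈ s, δ i) x = ∑ i ∈ s, δ i x := by
  classical
  induction s using Finset.induction_on with
  | empty => simp
  | insert i s hi ih => rw [Finset.sum_insert hi, Finset.sum_insert hi, Derivation.add_apply, ih]

lemma raise_apply (d : ℕ) (P : CoeffRing d) :
    raise d P = ∑ i : Fin d, ((d : ℚ) - ((i : ℕ) : ℚ)) • (X i.succ * pderiv i.castSucc P) := by
  have h : raise d = ∑ i : Fin d, (((d : ℚ) - ((i : ℕ) : ℚ)) • X i.succ : CoeffRing d) •
      (pderiv i.castSucc : Derivation ℚ (CoeffRing d) (CoeffRing d)) := by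
    refine derivation_ext fun j => ?_
    rw [raise, mkDerivation_X, derivation_sum_apply]
    simp only [Derivation.smul_apply, smul_eq_mul]
    induction j using Fin.lastCases with
    | last =>
      rw [Finset.sum_eq_zero]
      · simp
      · intro i _
        rw [pderiv_X_of_ne (Fin.castSucc_lt_last i).ne', mul_zero]
    | cast j =>
      rw [Finset.sum_eq_single j]
      · rw [pderiv_X_self, genCoeff_of_le (by simp)]
        simp [Algebra.smul_def, Fin.succ]
      · intro i _ hij
        rw [pderiv_X_of_ne (fun h => hij (Fin.castSucc_injective _ h.symm)), mul_zero]
      · simp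
  rw [h, derivation_sum_apply]
  simp

lemma lower_apply (d : ℕ) (P : CoeffRing d) :
    lower d P = ∑ i : Fin d, (((i : ℕ) : ℚ) + 1) • (X i.castSucc * pderiv i.succ P) := by
  have h : lower d = ∑ i : Fin d, ((((i : ℕ) : ℚ) + 1) • X i.castSucc : CoeffRing d) •
      (pderiv i.succ : Derivation ℚ (CoeffRing d) (CoeffRing d)) := by
    refine derivation_ext fun j => ?_
    rw [lower, mkDerivation_X, derivation_sum_apply]
    simp only [Derivation.smul_apply, smul_eq_mul]
    induction j using Fin.cases with
    | zero =>
      rw [Finset.sum_eq_zero]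
      · simp
      · intro i _
        rw [pderiv_X_of_ne (Fin.succ_ne_zero i).symm, mul_zero]
    | succ j =>
      rw [Finset.sum_eq_single j]
      · rw [pderiv_X_self, genCoeff_of_le (by simp)]
        simp [Algebra.smul_def, Fin.castSucc, Fin.castAdd, Fin.castLE]
      · intro i _ hij
        rw [pderiv_X_of_ne (fun h => hij (Fin.succ_injective _ h.symm)), mul_zero]
      · simp
  rw [h, derivation_sum_apply]
  simp

/-- With both derivations written as sums of a variable times a partial derivative, adjointness
reduces to C(d,i+1)(i+1) = C(d,i)(d-i), which dictates the weights 1/C(d,i). -/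
lemma pairing_raise {d : ℕ} (P Q : CoeffRing d) :
    pairing (invChoose d) P (raise d Q) = pairing (invChoose d) (lower d P) Q := by
  rw [raise_apply, lower_apply]
  simp only [map_sum, map_smul, LinearMap.sum_apply, LinearMap.smul_apply, pairing_mul_X,
    pairing_X_mul, smul_eq_mul]
  refine Finset.sum_congr rfl fun i _ => ?_
  rw [← mul_assoc, ← mul_assoc]
  congr 1
  have h2 := cast_choose_succ (S := ℚ) d i
  have h3 : (d.choose i : ℚ) ≠ 0 := by
    have : 0 < d.choose i := Nat.choose_pos (by omega)
    positivity
  have h4 : (d.choose (i + 1) : ℚ) ≠ 0 := by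
    have : 0 < d.choose (i + 1) := Nat.choose_pos (by omega)
    positivity
  simp only [invChoose, Fin.val_succ, Fin.val_castSucc]
  field_simp
  linear_combination -h2

lemma pairing_lower {d : ℕ} (P Q : CoeffRing d) :
    pairing (invChoose d) P (lower d Q) = pairing (invChoose d) (raise d P) Q := by
  rw [pairing_comm, ← pairing_raise, pairing_comm]

/-- A functional invariant under `raise` that kills the multiples of the lowest coefficient of a
covariant kills the multiples of all its coefficients. -/
lemma pairing_mul_genQuad {d r : ℕ} (hr : r ≤ d) {P : CoeffRing d} (hP : lower d P = 0)
    (h0 : ∀ x, pairing (invChoose d) P (x * genQuad d r 0) = 0) (n : ℕ) (x : CoeffRing d) :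
    pairing (invChoose d) P (x * genQuad d r n) = 0 := by
  induction n generalizing x with
  | zero => exact h0 x
  | succ n ih =>
    -- The Leibniz rule splits this into n + 1 times the wanted pairing and a multiple of the n-th
    -- coefficient, covered by the induction hypothesis for another x.
    have h1 : pairing (invChoose d) P (raise d (x * genQuad d r n)) = 0 := by
      rw [pairing_raise, hP]; simp
    rw [Derivation.leibniz, raise_genQuad hr, smul_eq_mul, smul_eq_mul, map_add,
      mul_comm (genQuad d r n), ih, add_zero] at h1
    have e : x * (((n + 1 : ℕ) : CoeffRing d) * genQuad d r (n + 1)) =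
        ((n + 1 : ℕ) : ℚ) • (x * genQuad d r (n + 1)) := by
      rw [Algebra.smul_def, map_natCast]; ring
    rw [e, map_smul, smul_eq_mul] at h1
    exact (mul_eq_zero.mp h1).resolve_left (by positivity)

/-! ### From the bivariate transvectants to their dehomogenisations -/

section Homogenization

variable {K : Type*} [CommRing K]

/-- The exponent vector of `x_1 ^ (N - n) x_2 ^ n`. -/
def binaryExponent (N n : ℕ) : Fin 2 →₀ ℕ := Finsupp.single 0 (N - n) + Finsupp.single 1 n

/-- The binary form of order `N` with the given dehomogenisation. -/
def homogenization (N : ℕ) (p : Polynomial K) : MvPolynomial (Fin 2) K :=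
  ∑ n ∈ Finset.range (N + 1), monomial (binaryExponent N n) (p.coeff n)

lemma homogenization_add (N : ℕ) (p q : Polynomial K) :
    homogenization N (p + q) = homogenization N p + homogenization N q := by
  simp [homogenization, Finset.sum_add_distrib]

lemma homogenization_C_mul (N : ℕ) (c : K) (p : Polynomial K) :
    homogenization N (Polynomial.C c * p) = C c * homogenization N p := by
  simp [homogenization, Finset.mul_sum, C_mul_monomial]

lemma homogenization_sum {ι : Type*} (N : ℕ) (s : Finset ι) (p : ι → Polynomial K) :
    homogenization N (∑ i ∈ s, p i) = ∑ i ∈ s, homogenization N (p i) := by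
  classical
  induction s using Finset.induction_on with
  | empty => simp [homogenization]
  | insert i s hi ih => rw [Finset.sum_insert hi, Finset.sum_insert hi, homogenization_add, ih]

lemma homogenization_monomial {N n : ℕ} (h : n ≤ N) (c : K) :
    homogenization N (Polynomial.monomial n c) = monomial (binaryExponent N n) c := by
  rw [homogenization, Finset.sum_eq_single n]
  · simp
  · intro m _ hm
    rw [Polynomial.coeff_monomial_of_ne _ hm, monomial_zero]
  · intro h'; simp at h'; omega

lemma homogenization_mul {M N : ℕ} {p q : Polynomial K} (hp : p.natDegree ≤ M)
    (hq : q.natDegree ≤ N) :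
    homogenization (M + N) (p * q) = homogenization M p * homogenization N q := by
  have h : p * q = ∑ i ∈ Finset.range (M + 1), ∑ j ∈ Finset.range (N + 1),
      Polynomial.monomial (i + j) (p.coeff i * q.coeff j) := by
    conv_lhs => rw [p.as_sum_range' (M + 1) (by omega), q.as_sum_range' (N + 1) (by omega)]
    simp [Finset.sum_mul_sum, Polynomial.monomial_mul_monomial]
  rw [h, homogenization_sum, homogenization, homogenization, Finset.sum_mul_sum]
  refine Finset.sum_congr rfl fun i hi => ?_
  rw [homogenization_sum]
  refine Finset.sum_congr rfl fun j hj => ?_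
  rw [Finset.mem_range] at hi hj
  have e : binaryExponent M i + binaryExponent N j = binaryExponent (M + N) (i + j) := by
    ext k
    fin_cases k <;> simp [binaryExponent] <;> omega
  rw [homogenization_monomial (by omega), monomial_mul, e]

lemma coeff_homogenization (N : ℕ) (p : Polynomial K) (s : Fin 2 →₀ ℕ) :
    coeff s (homogenization N p) = if s 0 + s 1 = N then p.coeff (s 1) else 0 := by
  classical
  have key : ∀ n, n ≤ N → (binaryExponent N n = s ↔ s 0 + s 1 = N ∧ n = s 1) := by
    intro n hn
    constructor
    · rintro rfl; simp [binaryExponent]; omega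
    · rintro ⟨h1, h2⟩
      ext k
      fin_cases k <;> simp [binaryExponent] <;> omega
  rw [homogenization, coeff_sum]
  simp only [coeff_monomial]
  split_ifs with h
  · rw [Finset.sum_eq_single (s 1)]
    · rw [if_pos ((key _ (by omega)).mpr ⟨h, rfl⟩)]
    · intro n hn hne
      rw [Finset.mem_range] at hn
      rw [if_neg fun h' => hne ((key n (by omega)).mp h').2]
    · intro h'; simp at h'; omega
  · refine Finset.sum_eq_zero fun n hn => ?_
    rw [Finset.mem_range] at hn
    rw [if_neg fun h' => h ((key n (by omega)).mp h').1]

lemma iterate_pderiv_monomial {σ : Type*} (i : σ) (n : ℕ) (s : σ →₀ ℕ) (c : K) :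
    (pderiv i)^[n] (monomial s c) =
      monomial (s - Finsupp.single i n) (c * ((s i).descFactorial n : K)) := by
  induction n with
  | zero => simp
  | succ n ih =>
    rw [Function.iterate_succ_apply', ih, pderiv_monomial, tsub_tsub, ← Finsupp.single_add]
    congr 1
    rw [Nat.descFactorial_succ]
    simp
    ring

lemma iterate_pderiv_sum {σ ι : Type*} (i : σ) (n : ℕ) (s : Finset ι)
    (f : ι → MvPolynomial σ K) :
    (pderiv i)^[n] (∑ j ∈ s, f j) = ∑ j ∈ s, (pderiv i)^[n] (f j) := by
  induction n with
  | zero => simp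
  | succ n ih => simp only [Function.iterate_succ_apply', ih, map_sum]

end Homogenization

/-- The left side is the numerical factor left on x_1^(d-p-l) x_2^(p+l) after i derivatives in x_1
and l in x_2. The identity shows that a partial derivative of F again has binomially normalised
coefficients, up to a factor depending only on the order i + l. -/
lemma choose_mul_descFactorial {d i l p : ℕ} (hi : i + l ≤ d) (hp : p ≤ d - (i + l)) :
    d.choose (p + l) * (p + l).descFactorial l * (d - (p + l)).descFactorial i =
      d.descFactorial (i + l) * (d - (i + l)).choose p := by
  obtain ⟨t, rfl⟩ : ∃ t, d = p + (i + l) + t := ⟨d - (p + (i + l)), by omega⟩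
  have e1 : p + (i + l) + t - (i + l) = p + t := by omega
  have e2 : p + (i + l) + t - (p + l) = i + t := by omega
  rw [e1, e2]
  have h1 : (p + (i + l) + t).choose (p + l) * (p + l).factorial * (i + t).factorial =
      (p + (i + l) + t).factorial := by
    rw [← Nat.choose_mul_factorial_mul_factorial (show p + l ≤ p + (i + l) + t by omega), e2]
  have h2 : (p + t).choose p * p.factorial * t.factorial = (p + t).factorial := by
    rw [← Nat.choose_mul_factorial_mul_factorial (show p ≤ p + t by omega)]
    simp
  have h3 : p.factorial * (p + l).descFactorial l = (p + l).factorial := by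
    have := Nat.factorial_mul_descFactorial (show l ≤ p + l by omega)
    simpa using this
  have h4 : t.factorial * (i + t).descFactorial i = (i + t).factorial := by
    have := Nat.factorial_mul_descFactorial (show i ≤ i + t by omega)
    simpa using this
  have h5 : (p + t).factorial * (p + (i + l) + t).descFactorial (i + l) =
      (p + (i + l) + t).factorial := by
    have := Nat.factorial_mul_descFactorial (show i + l ≤ p + (i + l) + t by omega)
    rwa [e1] at this
  have hpos : 0 < p.factorial * t.factorial := by positivity
  refine Nat.eq_of_mul_eq_mul_left hpos ?_
  calc _ = (p + (i + l) + t).choose (p + l) * (p.factorial * (p + l).descFactorial l) *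
        (t.factorial * (i + t).descFactorial i) := by ring
    _ = (p + t).factorial * (p + (i + l) + t).descFactorial (i + l) := by rw [h3, h4, h1, h5]
    _ = _ := by rw [← h2]; ring

lemma genericForm_eq (d : ℕ) : genericForm d = ∑ j ∈ Finset.range (d + 1),
    monomial (binaryExponent d j) ((d.choose j : CoeffRing d) * genCoeff d j) := by
  rw [genericForm, Finset.sum_range]
  refine Finset.sum_congr rfl fun i _ => ?_
  rw [genCoeff_val, binaryExponent, Algebra.smul_def, mul_assoc,
    show (X 0 ^ (d - (i : ℕ)) * X 1 ^ (i : ℕ) : MvPolynomial (Fin 2) (CoeffRing d)) =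
      monomial (Finsupp.single 0 (d - (i : ℕ)) + Finsupp.single 1 (i : ℕ)) 1 by
      rw [X_pow_eq_monomial, X_pow_eq_monomial, monomial_mul, one_mul], C_mul_monomial, mul_one,
    map_natCast, ← map_natCast (C : CoeffRing d →+* _), C_mul_monomial]

lemma iterate_pderiv_genericForm {d i l : ℕ} (h : i + l ≤ d) :
    (pderiv 0)^[i] ((pderiv 1)^[l] (genericForm d)) =
      C (d.descFactorial (i + l) : CoeffRing d) *
        homogenization (d - (i + l)) (rowPoly (genCoeff d) (d - (i + l)) l) := by
  rw [genericForm_eq, iterate_pderiv_sum, iterate_pderiv_sum, homogenization, Finset.mul_sum]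
  simp only [iterate_pderiv_monomial]
  symm
  refine Finset.sum_of_injOn (fun p => p + l) (fun a _ b _ hab => Nat.add_right_cancel hab)
    (fun p hp => ?_) (fun j hj hj' => ?_) (fun p hp => ?_)
  · simp at hp ⊢; omega
  · have hj'' : j < l ∨ d - j < i := by
      by_contra! hcon
      refine hj' ⟨j - l, ?_, ?_⟩
      · simp at hj ⊢; omega
      · simp; omega
    rcases hj'' with hlt | hlt
    · simp [binaryExponent, Nat.descFactorial_eq_zero_iff_lt.mpr hlt]
    · simp [binaryExponent, Nat.descFactorial_eq_zero_iff_lt.mpr hlt]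
  · rw [Finset.mem_range] at hp
    have hc := congrArg (Nat.cast : ℕ → CoeffRing d)
      (choose_mul_descFactorial h (show p ≤ d - (i + l) by omega))
    push_cast at hc
    have e : (binaryExponent d (p + l) - Finsupp.single 1 l) - Finsupp.single 0 i =
        binaryExponent (d - (i + l)) p := by
      ext k
      fin_cases k <;> simp [binaryExponent] <;> omega
    simp only [e, C_mul_monomial, coeff_rowPoly]
    congr 1
    simp only [binaryExponent, Finsupp.coe_add, Finsupp.coe_tsub, Pi.add_apply, Pi.sub_apply,
      Finsupp.single_eq_same, Finsupp.single_apply]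
    simp only [Fin.isValue, one_ne_zero, zero_ne_one, if_false, zero_add, add_zero, tsub_zero]
    linear_combination -genCoeff d (p + l) * hc

/-- The coefficients of the quadratic covariants of the generic form. -/
lemma coeff_quadCovariant {d k : ℕ} (h : 2 * k ≤ d) (s : Fin 2 →₀ ℕ) :
    coeff s (quadCovariant d k) =
      if s 0 + s 1 = 2 * (d - 2 * k) then genQuad d (2 * k) (s 1) else 0 := by
  have key : quadCovariant d k = homogenization (2 * (d - 2 * k))
      (quadPoly (genCoeff d) (d - 2 * k) (2 * k)) := by
    rw [quadCovariant, transvectant, if_pos (by simpa using h), quadPoly, homogenization_sum,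
      Finset.smul_sum]
    refine Finset.sum_congr rfl fun l hl => ?_
    rw [Finset.mem_range] at hl
    have e1 : 2 * k - l + l = 2 * k := by omega
    have e2 : l + (2 * k - l) = 2 * k := by omega
    rw [iterate_pderiv_genericForm (by omega), iterate_pderiv_genericForm (by omega), e1, e2,
      homogenization_C_mul, two_mul (d - 2 * k),
      homogenization_mul (natDegree_rowPoly_le _ _ _) (natDegree_rowPoly_le _ _ _)]
    have hf : ((d - 2 * k).factorial : ℚ) * (d.descFactorial (2 * k) : ℚ) = d.factorial := by
      exact_mod_cast Nat.factorial_mul_descFactorial h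
    have hd : (d.factorial : ℚ) ≠ 0 := by exact_mod_cast d.factorial_ne_zero
    -- The normalisation ((d-2k)!/d!)² cancels the two descending factorials produced by
    -- differentiation.
    have hq : (((d - 2 * k).factorial : ℚ) * ((d - 2 * k).factorial : ℚ) /
        ((d.factorial : ℚ) * (d.factorial : ℚ))) * ((-1) ^ l * ((2 * k).choose l : ℚ)) *
        ((d.descFactorial (2 * k) : ℚ) * (d.descFactorial (2 * k) : ℚ)) =
        (-1) ^ l * ((2 * k).choose l : ℚ) := by
      rw [← hf] at hd ⊢
      have h1 := left_ne_zero_of_mul hd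
      have h2 := right_ne_zero_of_mul hd
      field_simp
    have hq' := congrArg (algebraMap ℚ (MvPolynomial (Fin 2) (CoeffRing d))) hq
    simp only [map_mul, map_pow, map_neg, map_one, map_natCast] at hq'
    rw [Algebra.smul_def, Algebra.smul_def]
    simp only [map_mul, map_pow, map_neg, map_one, map_natCast]
    linear_combination (homogenization (d - 2 * k) (rowPoly (genCoeff d) (d - 2 * k) l) *
      homogenization (d - 2 * k) (rowPoly (genCoeff d) (d - 2 * k) (2 * k - l))) * hq'
  rw [key, coeff_homogenization]
  rfl

lemma filtrationIdeal_eq {d q : ℕ} (h : 2 * q ≤ d) : filtrationIdeal d q =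
    Ideal.span {c | ∃ k, 1 ≤ k ∧ k ≤ q ∧ ∃ n, c = genQuad d (2 * k) n} := by
  apply le_antisymm
  · refine Ideal.span_le.mpr fun x hx => ?_
    induction hx using Submodule.span_induction with
    | mem x hx =>
      obtain ⟨k, hk1, hkq, s, rfl⟩ := hx
      rw [coeff_quadCovariant (by omega)]
      split_ifs
      · exact Ideal.subset_span ⟨k, hk1, hkq, s 1, rfl⟩
      · exact Ideal.zero_mem _
    | zero => exact Ideal.zero_mem _
    | add x y _ _ hx hy => exact Ideal.add_mem _ hx hy
    | smul a x _ hx => exact Submodule.smul_of_tower_mem _ a hx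
  · refine Ideal.span_le.mpr ?_
    rintro x ⟨k, hk1, hkq, n, rfl⟩
    rcases le_or_gt n (2 * (d - 2 * k)) with hn | hn
    · refine Ideal.subset_span (Submodule.subset_span ⟨k, hk1, hkq,
        binaryExponent (2 * (d - 2 * k)) n, ?_⟩)
      rw [coeff_quadCovariant (by omega), if_pos (by simp [binaryExponent]; omega)]
      simp [binaryExponent]
    · rw [SetLike.mem_coe, genQuad, quadCoeff_eq_zero _ _ _ _ hn]
      exact Ideal.zero_mem _

lemma genQuad_mem {d q k : ℕ} (h : 2 * q ≤ d) (hk : 1 ≤ k) (hkq : k ≤ q) (n : ℕ) :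
    genQuad d (2 * k) n ∈ filtrationIdeal d q := by
  rw [filtrationIdeal_eq h]
  exact Ideal.subset_span ⟨k, hk, hkq, n, rfl⟩

/-! ### A power of the irrelevant ideal carries H_{2q+2} into J_{2q} -/

/-- In characteristic zero, a derivation that preserves an ideal preserves its radical. -/
lemma derivation_mem_radical {A : Type*} [CommRing A] [Algebra ℚ A] (δ : Derivation ℚ A A)
    {I : Ideal A} (hI : ∀ x ∈ I, δ x ∈ I) {x : A} (hx : x ∈ I.radical) : δ x ∈ I.radical := by
  obtain ⟨n, hn⟩ := hx
  -- Each step trades one factor x for two factors δ x: differentiate, multiply by δ x, remove the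
  -- term containing δ (δ x), and divide by the exponent of x.
  have key : ∀ k ≤ n, x ^ (n - k) * δ x ^ (2 * k) ∈ I := by
    intro k
    induction k with
    | zero => intro _; simpa using hn
    | succ k ih =>
      intro hk
      obtain ⟨j, rfl⟩ : ∃ j, n = k + 1 + j := ⟨n - (k + 1), by omega⟩
      have h1 := ih (by omega)
      rw [show k + 1 + j - k = j + 1 by omega] at h1
      rw [show k + 1 + j - (k + 1) = j by omega]
      have h2 := I.mul_mem_right (δ x) (hI _ h1)
      have h3 := I.mul_mem_left (((2 * k : ℕ) : A) * δ (δ x)) h1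
      have h4 : δ (x ^ (j + 1) * δ x ^ (2 * k)) * δ x -
          ((2 * k : ℕ) : A) * δ (δ x) * (x ^ (j + 1) * δ x ^ (2 * k)) =
          ((j + 1 : ℕ) : ℚ) • (x ^ j * δ x ^ (2 * (k + 1))) := by
        rw [Derivation.leibniz, Derivation.leibniz_pow, Derivation.leibniz_pow,
          Nat.cast_smul_eq_nsmul ℚ]
        rcases k with _ | k
        · simp; ring
        · rw [show 2 * (k + 1) - 1 = 2 * k + 1 by omega]
          simp only [smul_eq_mul, nsmul_eq_mul, Nat.add_sub_cancel]
          push_cast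
          ring
      have h5 := I.sub_mem h2 h3
      rw [h4] at h5
      have h6 := Submodule.smul_of_tower_mem I (((j + 1 : ℕ) : ℚ)⁻¹) h5
      rwa [smul_smul, inv_mul_cancel₀ (by positivity), one_smul] at h6
  exact ⟨2 * n, by simpa using key n le_rfl⟩

section Geometric

variable {S : Type*} [CommRing S]

lemma quadCoeff_congr {u v : ℕ → S} {m r : ℕ} (h : ∀ i ≤ m + r, u i = v i) (n : ℕ) :
    quadCoeff u m r n = quadCoeff v m r n := by
  have key : ∀ i l, l ≤ r → (m.choose i : S) * u (i + l) = (m.choose i : S) * v (i + l) := by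
    intro i l hl
    rcases le_or_gt i m with hi | hi
    · rw [h _ (by omega)]
    · rw [Nat.choose_eq_zero_of_lt hi]; simp
  rw [quadCoeff_eq, quadCoeff_eq]
  refine Finset.sum_congr rfl fun l hl => ?_
  rw [Finset.mem_range] at hl
  congr 1
  refine Finset.sum_congr rfl fun x _ => ?_
  rw [key _ _ (by omega), key _ _ (by omega)]

/-- The transvectants of a form with itself vanish on powers of linear forms. -/
lemma quadCoeff_geometric (c t : S) {m r : ℕ} (hr : r ≠ 0) (n : ℕ) :
    quadCoeff (fun i => c * t ^ i) m r n = 0 := by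
  have h : quadCoeff (fun i => c * t ^ i) m r n =
      (∑ l ∈ Finset.range (r + 1), (-1 : S) ^ l * (r.choose l : S)) *
        ∑ x ∈ Finset.HasAntidiagonal.antidiagonal n,
          (m.choose x.1 : S) * (m.choose x.2 : S) * c ^ 2 * t ^ (n + r) := by
    rw [quadCoeff_eq, Finset.sum_mul]
    refine Finset.sum_congr rfl fun l hl => ?_
    congr 1
    refine Finset.sum_congr rfl fun x hx => ?_
    rw [Finset.HasAntidiagonal.mem_antidiagonal] at hx
    rw [Finset.mem_range] at hl
    have e : n + r = (x.1 + l) + (x.2 + (r - l)) := by omega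
    rw [e, pow_add _ (x.1 + l)]; ring
  have h0 := Int.alternating_sum_range_choose_of_ne hr
  have h1 := congrArg (Int.cast : ℤ → S) h0
  push_cast at h1
  rw [h, h1, zero_mul]

/-- A form with zero Hessian and invertible leading coefficient is a multiple of a power of a
linear form. -/
lemma eq_geometric_of_quadCoeff_eq_zero (hS : ∀ k : ℕ, k ≠ 0 → IsUnit (k : S)) {u : ℕ → S}
    (h0 : IsUnit (u 0)) {m : ℕ} (h : ∀ n, quadCoeff u m 2 n = 0) :
    ∃ t, ∀ n ≤ m + 2, u n = u 0 * t ^ n := by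
  obtain ⟨v, hv⟩ := h0.exists_right_inv
  -- The ratio t is forced to be u 1 / u 0.
  refine ⟨v * u 1, fun n => ?_⟩
  induction n using Nat.strong_induction_on with
  | _ n ih =>
    intro hn
    rcases n with _ | _ | n
    · simp
    · rw [zero_add, pow_one]; linear_combination -u 1 * hv
    · set t := v * u 1 with ht
      set D := u (n + 2) - u 0 * t ^ (n + 2) with hD
      have hgeo := quadCoeff_geometric (u 0) t (m := m) (two_ne_zero) n
      -- By induction `u` is geometric below n + 2, so a product of total index n + 2 can deviate
      -- only if one index is 0. Hence the n-th Hessian coefficient is 2 C(m,n) u_0 D, with a unit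
      -- in front of D.
      have hprod : ∀ i j, i + j = n + 2 →
          u i * u j - (u 0 * t ^ i) * (u 0 * t ^ j) =
            (if i = 0 then u 0 * D else 0) + (if j = 0 then u 0 * D else 0) := by
        intro i j hij
        rcases Nat.eq_zero_or_pos i with rfl | hi
        · rw [if_pos rfl, if_neg (by omega), show j = n + 2 by omega, hD]; ring
        · rcases Nat.eq_zero_or_pos j with rfl | hj
          · rw [if_pos rfl, if_neg (by omega), show i = n + 2 by omega, hD]; ring
          · rw [if_neg (by omega), if_neg (by omega), ih i (by omega) (by omega),
              ih j (by omega) (by omega)]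
            ring
      have hdiff : quadCoeff u m 2 n - quadCoeff (fun i => u 0 * t ^ i) m 2 n =
          ((2 * m.choose n : ℕ) : S) * (u 0 * D) := by
        rw [quadCoeff_eq, quadCoeff_eq, ← Finset.sum_sub_distrib]
        simp only [← mul_sub, ← Finset.sum_sub_distrib]
        have : ∀ l ∈ Finset.range (2 + 1), (-1 : S) ^ l * ((2 : ℕ).choose l : S) *
            ∑ x ∈ Finset.HasAntidiagonal.antidiagonal n,
              ((m.choose x.1 : S) * u (x.1 + l) * ((m.choose x.2 : S) * u (x.2 + (2 - l))) -
                (m.choose x.1 : S) * (u 0 * t ^ (x.1 + l)) *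
                  ((m.choose x.2 : S) * (u 0 * t ^ (x.2 + (2 - l))))) =
            if l = 1 then 0 else (m.choose n : S) * (u 0 * D) := by
          intro l hl
          have hsum : ∑ x ∈ Finset.HasAntidiagonal.antidiagonal n,
              ((m.choose x.1 : S) * u (x.1 + l) * ((m.choose x.2 : S) * u (x.2 + (2 - l))) -
                (m.choose x.1 : S) * (u 0 * t ^ (x.1 + l)) *
                  ((m.choose x.2 : S) * (u 0 * t ^ (x.2 + (2 - l))))) =
              ∑ x ∈ Finset.HasAntidiagonal.antidiagonal n,
                (m.choose x.1 : S) * (m.choose x.2 : S) *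
                  ((if x.1 + l = 0 then u 0 * D else 0) +
                    (if x.2 + (2 - l) = 0 then u 0 * D else 0)) := by
            refine Finset.sum_congr rfl fun x hx => ?_
            rw [Finset.HasAntidiagonal.mem_antidiagonal] at hx
            rw [Finset.mem_range] at hl
            rw [← hprod _ _ (by omega)]; ring
          rw [hsum]
          rw [Finset.mem_range] at hl
          interval_cases l
          · rw [Finset.sum_eq_single (0, n)]
            · simp
            · intro x hx hne
              rw [Finset.HasAntidiagonal.mem_antidiagonal] at hx
              have : x.1 ≠ 0 := fun h => hne (Prod.ext h (by simp; omega))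
              simp [this]
            · simp
          · simp
          · rw [Finset.sum_eq_single (n, 0)]
            · simp
            · intro x hx hne
              rw [Finset.HasAntidiagonal.mem_antidiagonal] at hx
              have : x.2 ≠ 0 := fun h => hne (Prod.ext (by simp; omega) h)
              simp [this]
            · simp
        rw [Finset.sum_congr rfl this]
        simp [Finset.sum_range_succ]
        ring
      rw [h, hgeo, sub_zero, ← mul_assoc] at hdiff
      have hu : IsUnit (((2 * m.choose n : ℕ) : S) * u 0) := by
        refine (hS _ ?_).mul h0
        have : 0 < m.choose n := Nat.choose_pos (by omega)
        omega
      have hD0 : D = 0 := (hu.mul_right_eq_zero).mp hdiff.symm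
      rw [hD] at hD0
      exact sub_eq_zero.mp hD0

end Geometric

/-- A power of `a_0` carries every quadratic covariant into the ideal of the Hessian. -/
lemma exists_pow_mul_genQuad_mem {d : ℕ} (hd : 2 ≤ d) {J : Ideal (CoeffRing d)}
    (hJ : ∀ n, genQuad d 2 n ∈ J) {r : ℕ} (hr0 : r ≠ 0) (hr : r ≤ d) (n : ℕ) :
    ∃ N : ℕ, genCoeff d 0 ^ N * genQuad d r n ∈ J := by
  -- After passing to R/J and inverting a_0 the Hessian is zero, so the generic form becomes
  -- geometric and its transvectants vanish. Vanishing in the localisation means being killed by a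
  -- power of a_0.
  let x := Ideal.Quotient.mk J (genCoeff d 0)
  let S := Localization.Away x
  let φ : CoeffRing d →+* S := (algebraMap (CoeffRing d ⧸ J) S).comp (Ideal.Quotient.mk J)
  have hS : ∀ k : ℕ, k ≠ 0 → IsUnit (k : S) := by
    intro k hk
    have h1 : IsUnit ((k : ℚ)) := by simpa using hk
    have h2 := h1.map (φ.comp (C : ℚ →+* CoeffRing d))
    simpa using h2
  have h0 : IsUnit (φ (genCoeff d 0)) :=
    IsLocalization.map_units S (⟨x, Submonoid.mem_powers x⟩ : Submonoid.powers x)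
  obtain ⟨t, ht⟩ := eq_geometric_of_quadCoeff_eq_zero hS (u := fun i => φ (genCoeff d i)) h0
    (m := d - 2) (fun n => by
      rw [← map_quadCoeff]
      have : Ideal.Quotient.mk J (genQuad d 2 n) = 0 := Ideal.Quotient.eq_zero_iff_mem.mpr (hJ n)
      simp only [φ, RingHom.comp_apply, this, map_zero])
  have hzero : φ (genQuad d r n) = 0 := by
    rw [genQuad, map_quadCoeff,
      quadCoeff_congr (v := fun i => φ (genCoeff d 0) * t ^ i) (fun i hi => ht i (by omega)),
      quadCoeff_geometric _ _ hr0]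
  obtain ⟨⟨y, N, hy⟩, hN⟩ :=
    (IsLocalization.map_eq_zero_iff (Submonoid.powers x) S _).mp hzero
  refine ⟨N, ?_⟩
  rw [← Ideal.Quotient.eq_zero_iff_mem, map_mul, map_pow]
  simp only at hy hN
  rw [← hN, ← hy]
  rfl

lemma raise_mem_filtrationIdeal {d q : ℕ} (h : 2 * q ≤ d) {x : CoeffRing d}
    (hx : x ∈ filtrationIdeal d q) : raise d x ∈ filtrationIdeal d q := by
  rw [filtrationIdeal_eq h] at hx
  induction hx using Submodule.span_induction with
  | mem x hx =>
    obtain ⟨k, hk1, hkq, n, rfl⟩ := hx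
    rw [raise_genQuad (by omega)]
    exact Ideal.mul_mem_left _ _ (genQuad_mem h hk1 hkq _)
  | zero => simp
  | add x y _ _ hx hy => rw [map_add]; exact Ideal.add_mem _ hx hy
  | smul a x hxm hx =>
    rw [smul_eq_mul, Derivation.leibniz]
    refine Ideal.add_mem _ (Ideal.mul_mem_left _ _ hx) ?_
    rw [smul_eq_mul]
    refine Ideal.mul_mem_right _ _ ?_
    rw [filtrationIdeal_eq h]; exact hxm

/-- The irrelevant ideal has a power that carries `H_{2q+2}` into `J_{2q}`. -/
lemma exists_pow_idealOfVars_le {d q : ℕ} (hq : 1 ≤ q) (h : 2 * (q + 1) ≤ d) :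
    ∃ N : ℕ, ∀ x ∈ idealOfVars (Fin (d + 1)) ℚ ^ N, ∀ n,
      x * genQuad d (2 * (q + 1)) n ∈ filtrationIdeal d q := by
  let J := filtrationIdeal d q
  -- Since J and the span of the coefficients of H_{2q+2} are stable under `raise`, so are this
  -- colon ideal and its radical. The radical contains a_0, hence every a_i.
  let K : Ideal (CoeffRing d) := Submodule.colon J (Set.range (genQuad d (2 * (q + 1))))
  have hK : ∀ x, x ∈ K ↔ ∀ n, x * genQuad d (2 * (q + 1)) n ∈ J := by
    intro x
    simp [K, Submodule.mem_colon]
  have hraise : ∀ x ∈ K, raise d x ∈ K := by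
    intro x hx
    rw [hK] at hx ⊢
    intro n
    have h1 := raise_mem_filtrationIdeal (by omega) (hx n)
    rw [Derivation.leibniz, raise_genQuad h, smul_eq_mul, smul_eq_mul] at h1
    have h2 := J.mul_mem_left ((n + 1 : ℕ) : CoeffRing d) (hx (n + 1))
    have h3 := J.sub_mem h1 h2
    convert h3 using 1
    ring
  have h0 : genCoeff d 0 ∈ K.radical := by
    have hJ : ∀ n, genQuad d 2 n ∈ J := fun n => genQuad_mem (k := 1) (by omega) le_rfl hq n
    choose N hN using exists_pow_mul_genQuad_mem (by omega) hJ
      (show 2 * (q + 1) ≠ 0 by omega) h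
    -- Coefficients beyond the order of H_{2q+2} are zero, so finitely many exponents have to be
    -- dominated.
    let N' := (Finset.range (2 * (d - 2 * (q + 1)) + 1)).sup N
    refine ⟨N', (hK _).mpr fun n => ?_⟩
    rcases le_or_gt n (2 * (d - 2 * (q + 1))) with hn | hn
    · have hle : N n ≤ N' := Finset.le_sup (f := N) (by simp; omega)
      rw [← Nat.sub_add_cancel hle, pow_add, mul_assoc]
      exact J.mul_mem_left _ (hN n)
    · rw [genQuad, quadCoeff_eq_zero _ _ _ _ hn, mul_zero]; exact J.zero_mem
  have hall : ∀ i ≤ d, genCoeff d i ∈ K.radical := by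
    intro i
    induction i with
    | zero => intro _; exact h0
    | succ i ih =>
      intro hi
      have h1 := derivation_mem_radical (raise d) hraise (ih (by omega))
      rw [raise_genCoeff] at h1
      have h2 : ((d : CoeffRing d) - (i : CoeffRing d)) * genCoeff d (i + 1) =
          ((d : ℚ) - (i : ℚ)) • genCoeff d (i + 1) := by
        rw [Algebra.smul_def, map_sub, map_natCast, map_natCast]
      rw [h2] at h1
      have h3 := Submodule.smul_of_tower_mem K.radical (((d : ℚ) - (i : ℚ))⁻¹) h1
      have h4 : (d : ℚ) - i ≠ 0 := by
        have : (i : ℚ) < d := by exact_mod_cast hi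
        linarith
      rwa [smul_smul, inv_mul_cancel₀ h4, one_smul] at h3
  have hle : idealOfVars (Fin (d + 1)) ℚ ≤ K.radical := by
    refine Ideal.span_le.mpr ?_
    rintro x ⟨i, rfl⟩
    have := hall i (by omega)
    rwa [genCoeff_val] at this
  obtain ⟨N, hN⟩ := Ideal.exists_pow_le_of_le_radical_of_fg hle (idealOfVars_fg _ _)
  exact ⟨N, fun x hx n => (hK x).mp (hN hx) n⟩

/-! ### Degree and weight, and agreement in large degrees -/

/-- The bigrading of `R` by degree and weight. -/
def bidegree (d : ℕ) (i : Fin (d + 1)) : ℕ × ℕ := (1, i)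

lemma isWeightedHomogeneous_genCoeff (d i : ℕ) :
    IsWeightedHomogeneous (bidegree d) (genCoeff d i) (1, i) := by
  rcases le_or_gt i d with h | h
  · rw [genCoeff_of_le h]
    exact isWeightedHomogeneous_X ℚ (bidegree d) ⟨i, Nat.lt_succ_of_le h⟩
  · rw [genCoeff_of_gt h]; exact isWeightedHomogeneous_zero ℚ _ _

lemma IsWeightedHomogeneous.natCast_mul {σ M : Type*} [AddCommMonoid M] {w : σ → M}
    {P : MvPolynomial σ ℚ} {m : M} (hP : IsWeightedHomogeneous w P m) (n : ℕ) :
    IsWeightedHomogeneous w ((n : MvPolynomial σ ℚ) * P) m := by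
  have := hP.C_mul (n : ℚ)
  rwa [map_natCast] at this

lemma IsWeightedHomogeneous.sign_mul {σ M : Type*} [AddCommMonoid M] {w : σ → M}
    {P : MvPolynomial σ ℚ} {m : M} (hP : IsWeightedHomogeneous w P m) (j n : ℕ) :
    IsWeightedHomogeneous w ((-1) ^ j * (n : MvPolynomial σ ℚ) * P) m := by
  have := hP.C_mul ((-1) ^ j * (n : ℚ))
  rwa [map_mul, map_pow, map_neg, map_one, map_natCast] at this

lemma isWeightedHomogeneous_genQuad (d r n : ℕ) :
    IsWeightedHomogeneous (bidegree d) (genQuad d r n) (2, n + r) := by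
  rw [genQuad, quadCoeff_eq]
  refine IsWeightedHomogeneous.sum _ _ _ fun l hl => ?_
  refine IsWeightedHomogeneous.sign_mul (IsWeightedHomogeneous.sum _ _ _ fun x hx => ?_) _ _
  rw [Finset.HasAntidiagonal.mem_antidiagonal] at hx
  rw [Finset.mem_range] at hl
  have := (IsWeightedHomogeneous.natCast_mul (isWeightedHomogeneous_genCoeff d (x.1 + l))
    ((d - r).choose x.1)).mul
    (IsWeightedHomogeneous.natCast_mul (isWeightedHomogeneous_genCoeff d (x.2 + (r - l)))
    ((d - r).choose x.2))
  convert this using 1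
  ext
  · simp
  · simp; omega

lemma isHomogeneous_of_bidegree {d m n : ℕ} {P : CoeffRing d}
    (hP : IsWeightedHomogeneous (bidegree d) P (m, n)) : P.IsHomogeneous m := by
  intro s hs
  have h := congrArg Prod.fst (hP hs)
  simp only [Finsupp.weight_apply, Finsupp.sum, Prod.fst_sum] at h ⊢
  simpa [bidegree] using h

lemma gradedPart_le_gradedPart_succ (d q t : ℕ) :
    gradedPart (filtrationIdeal d q) t ≤ gradedPart (filtrationIdeal d (q + 1)) t := by
  refine inf_le_inf_right _ ?_
  have : filtrationIdeal d q ≤ filtrationIdeal d (q + 1) := by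
    refine Ideal.span_mono (Submodule.span_mono ?_)
    rintro x ⟨k, h1, h2, h3⟩
    exact ⟨k, h1, by omega, h3⟩
  exact this

/-- The ideals `J_{2q}` and `J_{2q+2}` agree in all large degrees. -/
lemma exists_gradedPart_eq {d q : ℕ} (hq : 1 ≤ q) (h : 2 * (q + 1) ≤ d) :
    ∃ m, ∀ t, m ≤ t →
      gradedPart (filtrationIdeal d q) t = gradedPart (filtrationIdeal d (q + 1)) t := by
  obtain ⟨N, hN⟩ := exists_pow_idealOfVars_le hq h
  -- The generators have degree 2, so in degree t ≥ N + 2 their monomial cofactors have degree at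
  -- least N.
  refine ⟨N + 2, fun t ht => le_antisymm (gradedPart_le_gradedPart_succ d q t) ?_⟩
  rintro x ⟨hx, hxt⟩
  refine ⟨?_, hxt⟩
  have key : ∀ y ∈ filtrationIdeal d (q + 1),
      homogeneousComponent t y ∈ filtrationIdeal d q := by
    intro y hy
    rw [filtrationIdeal_eq h] at hy
    refine Submodule.span_induction (p := fun y _ => ∀ c : CoeffRing d,
      homogeneousComponent t (c * y) ∈ filtrationIdeal d q) ?_ ?_ ?_ ?_ hy 1 |> fun hh => by
        simpa using hh
    · rintro y ⟨k, hk1, hkq, n, rfl⟩ c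
      induction c using MvPolynomial.induction_on' with
      | add c c' hc hc' => rw [add_mul, map_add]; exact Ideal.add_mem _ hc hc'
      | monomial s b =>
        have hhom : (monomial s b * genQuad d (2 * k) n).IsHomogeneous (s.degree + 2) :=
          (isHomogeneous_monomial b rfl).mul
            (isHomogeneous_of_bidegree (isWeightedHomogeneous_genQuad d (2 * k) n))
        by_cases hst : s.degree + 2 = t
        · rw [homogeneousComponent_of_mem hhom, if_pos hst.symm]
          rcases Nat.lt_or_ge q k with hlt | hle
          · obtain rfl : k = q + 1 := by omega
            refine hN _ ?_ n
            rw [mem_pow_idealOfVars_iff']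
            intro s' hs'
            rw [coeff_monomial, if_neg]
            rintro rfl
            omega
          · exact Ideal.mul_mem_left _ _ (genQuad_mem (by omega) hk1 hle n)
        · rw [homogeneousComponent_of_mem hhom, if_neg (Ne.symm hst)]
          exact Ideal.zero_mem _
    · intro c; simp
    · intro y z _ _ hy hz c
      rw [mul_add, map_add]; exact Ideal.add_mem _ (hy c) (hz c)
    · intro a y _ hy c
      rw [smul_eq_mul, ← mul_assoc]; exact hy _
  have h1 := key x hx
  rwa [homogeneousComponent_of_mem hxt, if_pos rfl] at h1

/-! ### Criterion for an element to lie outside J_{2q} -/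

/-- A lower bound for the saturation sequence from an element of `J_{2q+2}` of degree `t` outside
`J_{2q}`. -/
lemma lt_saturationTerm {d q b t : ℕ} (hq : 1 ≤ q) (h : 2 * (q + 1) ≤ d) (hbt : b ≤ t)
    {P : CoeffRing d} (hP : P.IsHomogeneous t) (hmem : P ∈ filtrationIdeal d (q + 1))
    (hnot : P ∉ filtrationIdeal d q) : b < saturationTerm d q := by
  by_contra! hcon
  -- The set is nonempty, so its infimum is attained and is not the default value 0.
  have hS := Nat.sInf_mem (s := {m : ℕ | ∀ t, m ≤ t →
    gradedPart (filtrationIdeal d q) t = gradedPart (filtrationIdeal d (q + 1)) t})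
    (exists_gradedPart_eq hq h)
  have heq := hS t (hcon.trans hbt)
  have : P ∈ gradedPart (filtrationIdeal d (q + 1)) t := ⟨hmem, hP⟩
  rw [← heq] at this
  exact hnot this.1

/-- Orthogonality to the lowest coefficients of the covariants excludes membership. -/
lemma notMem_filtrationIdeal {d q : ℕ} (h : 2 * q ≤ d) {P : CoeffRing d} (hP0 : P ≠ 0)
    (hP : lower d P = 0)
    (horth : ∀ k, 1 ≤ k → k ≤ q → ∀ x, pairing (invChoose d) P (x * genQuad d (2 * k) 0) = 0) :
    P ∉ filtrationIdeal d q := by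
  intro hmem
  refine hP0 (eq_zero_of_pairing_self (invChoose d) (invChoose_pos d) ?_)
  have key : ∀ y ∈ filtrationIdeal d q, pairing (invChoose d) P y = 0 := by
    intro y hy
    rw [filtrationIdeal_eq h] at hy
    refine Submodule.span_induction (p := fun y _ => ∀ c : CoeffRing d,
      pairing (invChoose d) P (c * y) = 0) ?_ ?_ ?_ ?_ hy 1 |> fun hh => by simpa using hh
    · rintro y ⟨k, hk1, hkq, n, rfl⟩ c
      exact pairing_mul_genQuad (by omega) hP (horth k hk1 hkq) n c
    · intro c; simp
    · intro y z _ _ hy hz c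
      rw [mul_add, map_add, hy, hz, add_zero]
    · intro a y _ hy c
      rw [smul_eq_mul, ← mul_assoc]; exact hy _
  exact key P hmem

/-- Orthogonality to the multiples of the lowest coefficient of a covariant only has to be tested
on monomials of the right bidegree. -/
lemma pairing_mul_genQuad_zero {d r : ℕ} {P : CoeffRing d} {m : ℕ × ℕ}
    (hP : IsWeightedHomogeneous (bidegree d) P m)
    (H : ∀ s : Fin (d + 1) →₀ ℕ, Finsupp.weight (bidegree d) s + (2, r) = m →
      pairing (invChoose d) P (monomial s 1 * genQuad d r 0) = 0) (x : CoeffRing d) :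
    pairing (invChoose d) P (x * genQuad d r 0) = 0 := by
  induction x using MvPolynomial.induction_on' with
  | add p q hp hq => rw [add_mul, map_add, hp, hq, add_zero]
  | monomial s c =>
    have hc : monomial s c * genQuad d r 0 = c • (monomial s 1 * genQuad d r 0) := by
      rw [← smul_mul_assoc, smul_monomial, smul_eq_mul, mul_one]
    rw [hc, map_smul]
    by_cases h : Finsupp.weight (bidegree d) s + (2, r) = m
    · rw [H s h, smul_zero]
    · have hQ := (isWeightedHomogeneous_monomial (bidegree d) s (1 : ℚ) rfl).mul
        (isWeightedHomogeneous_genQuad d r 0)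
      rw [zero_add] at hQ
      rw [pairing_eq_zero_of_isWeightedHomogeneous _ hP hQ (Ne.symm h), smul_zero]

lemma weight_bidegree_fst {d : ℕ} (s : Fin (d + 1) →₀ ℕ) :
    (Finsupp.weight (bidegree d) s).1 = s.degree := by
  simp [Finsupp.weight_apply, Finsupp.sum, Prod.fst_sum, bidegree, Finsupp.degree_apply]

lemma exists_eq_single_add {σ : Type*} {s : σ →₀ ℕ} {n : ℕ} (h : s.degree = n + 1) :
    ∃ i t, s = Finsupp.single i 1 + t ∧ t.degree = n := by
  have hs : s ≠ 0 := by rintro rfl; simp at h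
  obtain ⟨i, hi⟩ := Finsupp.ne_iff.mp hs
  have hle : Finsupp.single i 1 ≤ s := by
    rw [Finsupp.single_le_iff]
    exact Nat.one_le_iff_ne_zero.mpr (by simpa using hi)
  refine ⟨i, s - Finsupp.single i 1, (add_tsub_cancel_of_le hle).symm, ?_⟩
  have h1 : (Finsupp.single i 1 + (s - Finsupp.single i 1)).degree = n + 1 := by
    rw [add_tsub_cancel_of_le hle, h]
  rw [map_add, Finsupp.degree_single] at h1
  omega

lemma exists_eq_single {d : ℕ} {s : Fin (d + 1) →₀ ℕ} (h : s.degree = 1) :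
    ∃ i, s = Finsupp.single i 1 ∧ Finsupp.weight (bidegree d) s = (1, (i : ℕ)) := by
  obtain ⟨i, t, rfl, ht⟩ := exists_eq_single_add h
  obtain rfl : t = 0 := (Finsupp.degree_eq_zero_iff t).mp ht
  exact ⟨i, by simp, by simp [Finsupp.weight_single, bidegree]⟩

lemma exists_eq_single_add_single {d : ℕ} {s : Fin (d + 1) →₀ ℕ} (h : s.degree = 2) :
    ∃ i j : Fin (d + 1), s = Finsupp.single i 1 + Finsupp.single j 1 ∧
      Finsupp.weight (bidegree d) s = (2, (i : ℕ) + j) := by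
  obtain ⟨i, t, rfl, ht⟩ := exists_eq_single_add h
  obtain ⟨j, rfl, hj⟩ := exists_eq_single ht
  refine ⟨i, j, rfl, ?_⟩
  rw [map_add, hj]
  simp [Finsupp.weight_single, bidegree]

/-! ### Covariants of degree three and four -/

/-- The scaled coefficient `(d choose i) a_i` of the generic form. -/
def scaledCoeff (d i : ℕ) : CoeffRing d := (d.choose i : CoeffRing d) * genCoeff d i

/-- The leading coefficient, up to a factor, of the transvectant `(F, H_{2k})_e`. -/
def cubicLead (d k e : ℕ) : CoeffRing d :=
  leadTransvectant d (2 * (d - 2 * k)) e (scaledCoeff d) (genQuad d (2 * k))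

/-- The transvectant of full order, up to a factor, of `H_{2k}` with itself. -/
def quarticInvariant (d k : ℕ) : CoeffRing d :=
  leadTransvectant (2 * (d - 2 * k)) (2 * (d - 2 * k)) (2 * (d - 2 * k))
    (genQuad d (2 * k)) (genQuad d (2 * k))

lemma lower_cubicLead {d k e : ℕ} (hk : 2 * k ≤ d) (he : e ≤ d) (heN : e ≤ 2 * (d - 2 * k)) :
    lower d (cubicLead d k e) = 0 := by
  refine lower_leadTransvectant (δ := (lower d).restrictScalars ℤ) he heN ?_ ?_ ?_ ?_
  · change lower d _ = 0
    rw [scaledCoeff, Derivation.leibniz, lower_genCoeff (by omega)]; simp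
  · intro n hn
    change lower d _ = _
    rw [scaledCoeff, scaledCoeff, Derivation.leibniz, lower_genCoeff (by omega),
      Derivation.map_natCast]
    simp only [smul_eq_mul, mul_zero, add_zero, Nat.add_sub_cancel]
    have := cast_choose_succ (S := CoeffRing d) d n
    push_cast
    linear_combination genCoeff d n * this
  · exact lower_genQuad_zero hk
  · exact fun n _ => lower_genQuad_succ hk n

lemma lower_quarticInvariant {d k : ℕ} (hk : 2 * k ≤ d) : lower d (quarticInvariant d k) = 0 :=
  lower_leadTransvectant (δ := (lower d).restrictScalars ℤ) le_rfl le_rfl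
    (lower_genQuad_zero hk) (fun n _ => lower_genQuad_succ hk n)
    (lower_genQuad_zero hk) (fun n _ => lower_genQuad_succ hk n)

lemma raise_quarticInvariant {d k : ℕ} (hk : 2 * k ≤ d) : raise d (quarticInvariant d k) = 0 := by
  have h0 : raise d (genQuad d (2 * k) (2 * (d - 2 * k))) = 0 := by
    rw [raise_genQuad hk, genQuad, quadCoeff_eq_zero _ _ _ _ (by omega), mul_zero]
  exact raise_leadTransvectant (δ := (raise d).restrictScalars ℤ) h0
    (fun n _ => raise_genQuad hk n) h0 (fun n _ => raise_genQuad hk n)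

lemma isWeightedHomogeneous_leadTransvectant {d M N e : ℕ} {α β : ℕ → CoeffRing d}
    {p q x y : ℕ} (hα : ∀ n, IsWeightedHomogeneous (bidegree d) (α n) (p, n + x))
    (hβ : ∀ n, IsWeightedHomogeneous (bidegree d) (β n) (q, n + y)) :
    IsWeightedHomogeneous (bidegree d) (leadTransvectant M N e α β) (p + q, e + x + y) := by
  refine IsWeightedHomogeneous.sum _ _ _ fun j hj => ?_
  rw [Finset.mem_range] at hj
  refine IsWeightedHomogeneous.sign_mul ?_ _ _
  convert (hα (e - j)).mul (hβ j) using 1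
  ext
  · simp
  · simp; omega

lemma isWeightedHomogeneous_cubicLead (d k e : ℕ) :
    IsWeightedHomogeneous (bidegree d) (cubicLead d k e) (3, e + 2 * k) := by
  have := isWeightedHomogeneous_leadTransvectant (M := d) (N := 2 * (d - 2 * k)) (e := e)
    (α := scaledCoeff d) (p := 1) (x := 0)
    (fun n => IsWeightedHomogeneous.natCast_mul (isWeightedHomogeneous_genCoeff d n) _)
    (isWeightedHomogeneous_genQuad d (2 * k))
  exact this

lemma isWeightedHomogeneous_quarticInvariant {d k : ℕ} (hk : 2 * k ≤ d) :
    IsWeightedHomogeneous (bidegree d) (quarticInvariant d k) (4, 2 * d) := by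
  have := isWeightedHomogeneous_leadTransvectant (M := 2 * (d - 2 * k)) (N := 2 * (d - 2 * k))
    (e := 2 * (d - 2 * k)) (isWeightedHomogeneous_genQuad d (2 * k))
    (isWeightedHomogeneous_genQuad d (2 * k))
  rwa [show 2 * (d - 2 * k) + 2 * k + 2 * k = 2 * d by omega] at this

lemma leadTransvectant_mem {d M N e : ℕ} {α β : ℕ → CoeffRing d} {I : Ideal (CoeffRing d)}
    (h : ∀ n, β n ∈ I) : leadTransvectant M N e α β ∈ I :=
  Ideal.sum_mem _ fun _ _ => I.mul_mem_left _ (I.mul_mem_left _ (h _))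

/-! ### Evaluation at forms with two nonzero coefficients -/

section Evaluation

/-- The sequence with entries `1` in positions `a` and `b`. -/
def twoPoint (a b i : ℕ) : ℚ := (if i = a then 1 else 0) + (if i = b then 1 else 0)

/-- The nonzero coefficient of `rowPoly (Pi.single a 1) m l`. -/
def shiftChoose (m a l : ℕ) : ℚ := if l ≤ a then (m.choose (a - l) : ℚ) else 0

lemma sum_antidiagonal_indicator (m n a b l l' : ℕ) :
    ∑ x ∈ Finset.HasAntidiagonal.antidiagonal n,
      ((m.choose x.1 : ℚ) * (if x.1 + l = a then 1 else 0)) *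
        ((m.choose x.2 : ℚ) * (if x.2 + l' = b then 1 else 0)) =
      if a + b = n + (l + l') then shiftChoose m a l * shiftChoose m b l' else 0 := by
  by_cases h : l ≤ a ∧ l' ≤ b ∧ a + b = n + (l + l')
  · obtain ⟨h1, h2, h3⟩ := h
    rw [if_pos h3, shiftChoose, shiftChoose, if_pos h1, if_pos h2,
      Finset.sum_eq_single (a - l, b - l')]
    · simp [Nat.sub_add_cancel h1, Nat.sub_add_cancel h2]
    · intro x hx hne
      rw [Finset.HasAntidiagonal.mem_antidiagonal] at hx
      rw [if_neg (show ¬ x.1 + l = a from fun h' => hne (Prod.ext (by simp; omega)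
        (by simp; omega)))]
      simp
    · intro hn
      exact absurd (Finset.HasAntidiagonal.mem_antidiagonal.mpr (by simp; omega)) hn
  · rw [Finset.sum_eq_zero]
    · split_ifs with h3
      · rw [shiftChoose, shiftChoose]
        split_ifs with h1 h2
        · exact absurd ⟨h1, h2, h3⟩ h
        all_goals simp
      · rfl
    · intro x hx
      rw [Finset.HasAntidiagonal.mem_antidiagonal] at hx
      by_cases h1 : x.1 + l = a
      · rw [if_neg (show ¬ x.2 + l' = b by omega)]; simp
      · rw [if_neg h1]; simp

/-- The transvectant of a binary form with two nonzero coefficients with itself. -/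
lemma quadCoeff_twoPoint (a b m r n : ℕ) :
    quadCoeff (twoPoint a b) m r n = ∑ l ∈ Finset.range (r + 1), (-1) ^ l * (r.choose l : ℚ) *
      ((if a + a = n + r then shiftChoose m a l * shiftChoose m a (r - l) else 0) +
      (if a + b = n + r then shiftChoose m a l * shiftChoose m b (r - l) else 0) +
      (if b + a = n + r then shiftChoose m b l * shiftChoose m a (r - l) else 0) +
      (if b + b = n + r then shiftChoose m b l * shiftChoose m b (r - l) else 0)) := by
  rw [quadCoeff_eq]
  refine Finset.sum_congr rfl fun l hl => ?_
  rw [Finset.mem_range] at hl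
  have e : l + (r - l) = r := by omega
  have key := fun s t => sum_antidiagonal_indicator m n s t l (r - l)
  rw [e] at key
  rw [← key, ← key, ← key, ← key, ← Finset.sum_add_distrib, ← Finset.sum_add_distrib,
    ← Finset.sum_add_distrib]
  congr 1
  refine Finset.sum_congr rfl fun x _ => ?_
  simp only [twoPoint]
  ring

/-- Evaluation of polynomials in the coefficients at the form with coefficients `twoPoint a b`. -/
def evalTwoPoint (d a b : ℕ) : CoeffRing d →+* ℚ := eval fun i => twoPoint a b i

lemma evalTwoPoint_genCoeff {d a b : ℕ} (ha : a ≤ d) (hb : b ≤ d) (i : ℕ) :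
    evalTwoPoint d a b (genCoeff d i) = twoPoint a b i := by
  rcases le_or_gt i d with h | h
  · rw [genCoeff_of_le h, evalTwoPoint, eval_X]
  · rw [genCoeff_of_gt h, map_zero, twoPoint, if_neg (by omega), if_neg (by omega), add_zero]

lemma evalTwoPoint_genQuad {d a b : ℕ} (ha : a ≤ d) (hb : b ≤ d) (r n : ℕ) :
    evalTwoPoint d a b (genQuad d r n) = quadCoeff (twoPoint a b) (d - r) r n := by
  rw [genQuad, map_quadCoeff]
  simp only [evalTwoPoint_genCoeff ha hb]

lemma map_leadTransvectant {S T : Type*} [CommRing S] [CommRing T] (φ : S →+* T) (M N e : ℕ)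
    (α β : ℕ → S) : φ (leadTransvectant M N e α β) =
      leadTransvectant M N e (fun i => φ (α i)) (fun i => φ (β i)) := by
  simp [leadTransvectant, map_sum]

lemma evalTwoPoint_cubicLead {d a b : ℕ} (ha : a ≤ d) (hb : b ≤ d) (k e : ℕ) :
    evalTwoPoint d a b (cubicLead d k e) =
      leadTransvectant d (2 * (d - 2 * k)) e (fun i => (d.choose i : ℚ) * twoPoint a b i)
        (quadCoeff (twoPoint a b) (d - 2 * k) (2 * k)) := by
  rw [cubicLead, map_leadTransvectant]
  simp only [scaledCoeff, map_mul, map_natCast, evalTwoPoint_genCoeff ha hb,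
    evalTwoPoint_genQuad ha hb]

lemma evalTwoPoint_quarticInvariant {d a b : ℕ} (ha : a ≤ d) (hb : b ≤ d) (k : ℕ) :
    evalTwoPoint d a b (quarticInvariant d k) =
      leadTransvectant (2 * (d - 2 * k)) (2 * (d - 2 * k)) (2 * (d - 2 * k))
        (quadCoeff (twoPoint a b) (d - 2 * k) (2 * k))
        (quadCoeff (twoPoint a b) (d - 2 * k) (2 * k)) := by
  rw [quarticInvariant, map_leadTransvectant]
  simp only [evalTwoPoint_genQuad ha hb]

end Evaluation

/-- Two linearly independent elements have a nonzero combination in the kernel of a functional;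
independence is certified by two ring homomorphisms to `ℚ`. -/
lemma exists_combination_ne_zero {A : Type*} [CommRing A] [Algebra ℚ A] (f : A →ₗ[ℚ] ℚ)
    (φ ψ : A →+* ℚ) (v w : A) (hdet : φ v * ψ w - ψ v * φ w ≠ 0) :
    ∃ x y : ℚ, f (x • v + y • w) = 0 ∧ x • v + y • w ≠ 0 := by
  by_cases hf : f v = 0
  · refine ⟨1, 0, by simp [hf], ?_⟩
    intro h0
    simp only [one_smul, zero_smul, add_zero] at h0
    simp [h0] at hdet
  · refine ⟨f w, -f v, by simp; ring, ?_⟩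
    intro h0
    have hg := congrArg φ h0
    have hh := congrArg ψ h0
    simp only [map_add, map_rat_smul, smul_eq_mul, map_zero] at hg hh
    have : f v * (φ v * ψ w - ψ v * φ w) = 0 := by linear_combination ψ v * hg - φ v * hh
    exact (mul_ne_zero hf hdet) this

/-! ### Degree three, d ≥ 4(q+1) -/

lemma shiftChoose_eq_zero {m a l : ℕ} (h : a < l ∨ m + l < a) : shiftChoose m a l = 0 := by
  rw [shiftChoose]
  split_ifs
  · rw [Nat.choose_eq_zero_of_lt (by omega)]; simp
  · rfl

lemma shiftChoose_of_eq_add {m a l x : ℕ} (h : a = l + x) :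
    shiftChoose m a l = (m.choose x : ℚ) := by
  rw [shiftChoose, if_pos (by omega)]
  congr 2; omega

lemma quadCoeff_twoPoint_zero {k e m : ℕ} (h : k < e) :
    quadCoeff (twoPoint k e) m (2 * k) 0 = (-1) ^ k * ((2 * k).choose k : ℚ) := by
  rw [quadCoeff_twoPoint, Finset.sum_eq_single k]
  · rw [if_pos (by omega), if_neg (by omega), if_neg (by omega), if_neg (by omega),
      shiftChoose_of_eq_add (a := k) (l := k) (x := 0) rfl,
      shiftChoose_of_eq_add (a := k) (l := 2 * k - k) (x := 0) (by omega)]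
    simp
  · intro l _ hl
    rw [if_pos (by omega), if_neg (by omega), if_neg (by omega), if_neg (by omega)]
    rcases Nat.lt_or_gt_of_ne hl with hlt | hlt
    · rw [shiftChoose_eq_zero (l := 2 * k - l) (Or.inl (by omega))]; simp
    · rw [shiftChoose_eq_zero (l := l) (Or.inl hlt)]; simp
  · intro hn; simp at hn; omega

/-- At this position only the products of entry k with entry e contribute. As e ≥ d - 1, all but two
terms on each side of the symmetry l ↦ 2k - l vanish, and the bound d ≥ 4k makes the positive one
dominate. -/
lemma quadCoeff_twoPoint_nonneg {d k e : ℕ} (hk : 2 ≤ k) (hd : 4 * k ≤ d)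
    (he : e = 2 * (d / 2)) : 0 ≤ quadCoeff (twoPoint k e) (d - 2 * k) (2 * k) (e - k) := by
  set m := d - 2 * k with hm
  set A : ℕ → ℚ := fun l => (-1) ^ l * ((2 * k).choose l : ℚ) *
    (shiftChoose m k l * shiftChoose m e (2 * k - l)) with hA
  have hsum : quadCoeff (twoPoint k e) m (2 * k) (e - k) =
      2 * ∑ l ∈ Finset.range (2 * k + 1), A l := by
    rw [quadCoeff_twoPoint, two_mul (∑ l ∈ _, A l)]
    -- The reflection l ↦ 2k - l exchanges the two cross terms and, 2k being even, preserves the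
    -- sign.
    nth_rewrite 2 [← Finset.sum_range_reflect]
    rw [← Finset.sum_add_distrib]
    refine Finset.sum_congr rfl fun l hl => ?_
    rw [Finset.mem_range] at hl
    rw [if_neg (by omega), if_pos (by omega), if_pos (by omega), if_neg (by omega)]
    simp only [hA]
    have e1 : 2 * k + 1 - 1 - l = 2 * k - l := by omega
    have e3 : (-1 : ℚ) ^ (2 * k - l) = (-1) ^ l := by
      have : (-1 : ℚ) ^ (2 * k - l) * (-1) ^ l = 1 := by
        rw [← pow_add, Nat.sub_add_cancel (by omega), pow_mul]; simp
      have h2 : (-1 : ℚ) ^ l * (-1) ^ l = 1 := by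
        rw [← mul_pow]; simp
      linear_combination (-1) ^ l * this - (-1) ^ (2 * k - l) * h2
    rw [e1, Nat.sub_sub_self (by omega), e3, Nat.choose_symm (by omega)]
    ring
  have hA2 : ∀ l, 2 ≤ l → l ≤ 2 * k → A l = 0 := by
    intro l hl hl2
    simp only [hA]
    rw [shiftChoose_eq_zero (a := e) (l := 2 * k - l) (Or.inr (by omega))]; simp
  have h01 : ∑ l ∈ Finset.range (2 * k + 1), A l = A 0 + A 1 := by
    rw [← Finset.sum_subset (s₁ := Finset.range 2)]
    · simp [Finset.sum_range_succ]
    · intro l hl; simp at hl ⊢; omega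
    · intro l hl hl'
      simp at hl hl'
      exact hA2 l (by omega) (by omega)
  have hc : (m.choose k : ℚ) * k = (m.choose (k - 1) : ℚ) * (m - (k - 1 : ℕ)) := by
    have := cast_choose_succ (S := ℚ) m (k - 1)
    rw [Nat.sub_add_cancel (by omega)] at this
    rw [← this, Nat.cast_sub (by omega)]; push_cast; ring
  rw [hsum, h01]
  refine mul_nonneg (by norm_num) ?_
  simp only [hA]
  rw [shiftChoose_of_eq_add (a := k) (l := 0) (x := k) (by omega),
    shiftChoose_of_eq_add (a := k) (l := 1) (x := k - 1) (by omega),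
    shiftChoose_of_eq_add (a := e) (l := 2 * k - 0) (x := e - 2 * k) (by omega),
    shiftChoose_of_eq_add (a := e) (l := 2 * k - 1) (x := e - 2 * k + 1) (by omega)]
  -- For even d, e = d and the l = 1 term vanishes too. For odd d, e = d - 1 and it remains to
  -- compare m C(m,k) with 2k C(m,k-1).
  rcases Nat.even_or_odd' d with ⟨c, hc' | hc'⟩
  · rw [show e - 2 * k = m by omega, Nat.choose_self, Nat.choose_succ_self]
    simp
  · obtain ⟨m', hm'⟩ : ∃ m', m = m' + 1 := ⟨m - 1, by omega⟩
    rw [show e - 2 * k = m' by omega, hm', Nat.choose_succ_self_right, Nat.choose_self, ← hm']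
    have hk1 : ((k - 1 : ℕ) : ℚ) = k - 1 := by
      rw [Nat.cast_sub (by omega), Nat.cast_one]
    rw [hk1] at hc
    have hmk : (2 * k + 1 : ℚ) ≤ m := by exact_mod_cast (show 2 * k + 1 ≤ m by omega)
    have hm1 : (m : ℚ) = m' + 1 := by exact_mod_cast hm'
    have hk0 : (2 : ℚ) ≤ k := by exact_mod_cast hk
    have hx : (0 : ℚ) ≤ (m.choose (k - 1) : ℚ) := by positivity
    -- As k C(m,k) = (m-k+1) C(m,k-1), this is the comparison after cancelling C(m,k-1); it follows
    -- from m ≥ 2k + 1.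
    have hy : 2 * (k : ℚ) ^ 2 ≤ m * (m - (k - 1)) := by nlinarith
    have hz := mul_le_mul_of_nonneg_left hy hx
    have hgoal : 0 ≤ k * ((m.choose k : ℚ) * m - 2 * k * (m.choose (k - 1) : ℚ)) := by
      have : k * ((m.choose k : ℚ) * m - 2 * k * (m.choose (k - 1) : ℚ)) =
          (m.choose (k - 1) : ℚ) * (m * (m - (k - 1))) -
            (m.choose (k - 1) : ℚ) * (2 * (k : ℚ) ^ 2) := by
        linear_combination (m : ℚ) * hc
      linarith
    have := nonneg_of_mul_nonneg_right hgoal (by linarith)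
    simp only [pow_zero, Nat.choose_zero_right, pow_one, Nat.choose_one_right]
    push_cast
    linarith

/-- At the form with a_k = a_e = 1 only the terms j = 0 and j = e - k survive. Since e is even, both
carry the sign (-1)^k, so a positive and a nonnegative quantity are added. -/
lemma cubicLead_ne_zero {d k e : ℕ} (hk : 2 ≤ k) (hd : 4 * k ≤ d) (he : e = 2 * (d / 2)) :
    cubicLead d k e ≠ 0 := by
  have hle : e ≤ d := by omega
  have hke : 2 * k < e := by omega
  have h0 : twoPoint k e k = 1 := by simp [twoPoint]; omega
  have h1 : twoPoint k e e = 1 := by simp [twoPoint]; omega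
  have hv : evalTwoPoint d k e (cubicLead d k e) = (-1) ^ k *
      (((d - e).factorial * (2 * (d - 2 * k)).factorial : ℕ) *
        (d.choose e * ((2 * k).choose k : ℚ)) +
      ((d - e + (e - k)).factorial * (2 * (d - 2 * k) - (e - k)).factorial : ℕ) *
        (d.choose k * quadCoeff (twoPoint k e) (d - 2 * k) (2 * k) (e - k))) := by
    rw [evalTwoPoint_cubicLead (by omega) hle, leadTransvectant,
      ← Finset.sum_subset (s₁ := {0, e - k})]
    · rw [Finset.sum_pair (by omega), quadCoeff_twoPoint_zero (by omega), Nat.sub_zero,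
        Nat.sub_zero, h1, Nat.sub_sub_self (by omega), h0]
      have e3 : (-1 : ℚ) ^ (e - k) = (-1) ^ k := by
        have h3 : (-1 : ℚ) ^ (e - k) * (-1) ^ k = 1 := by
          rw [← pow_add, Nat.sub_add_cancel (by omega), he, pow_mul]; simp
        have h2 : (-1 : ℚ) ^ k * (-1) ^ k = 1 := by
          rw [← mul_pow]; simp
        linear_combination (-1) ^ k * h3 - (-1) ^ (e - k) * h2
      rw [e3, add_zero, pow_zero]
      ring
    · intro j hj
      simp at hj ⊢
      omega
    · intro j hj hj'
      simp at hj hj'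
      rw [twoPoint, if_neg (by omega), if_neg (by omega)]
      simp
  intro hzero
  rw [hzero, map_zero] at hv
  have hn := quadCoeff_twoPoint_nonneg hk hd he
  have hp1 : (0 : ℚ) < d.choose e := by exact_mod_cast Nat.choose_pos hle
  have hp2 : (0 : ℚ) < (2 * k).choose k := by exact_mod_cast Nat.choose_pos (by omega)
  have hpos : 0 < ((((d - e).factorial * (2 * (d - 2 * k)).factorial : ℕ) : ℚ) *
        (d.choose e * ((2 * k).choose k : ℚ)) +
      (((d - e + (e - k)).factorial * (2 * (d - 2 * k) - (e - k)).factorial : ℕ) : ℚ) *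
        (d.choose k * quadCoeff (twoPoint k e) (d - 2 * k) (2 * k) (e - k))) := by
    have : (0 : ℚ) < ((d - e).factorial * (2 * (d - 2 * k)).factorial : ℕ) := by
      exact_mod_cast Nat.mul_pos (Nat.factorial_pos _) (Nat.factorial_pos _)
    exact add_pos_of_pos_of_nonneg (by positivity) (by positivity)
  have := mul_ne_zero (pow_ne_zero k (by norm_num : (-1 : ℚ) ≠ 0)) hpos.ne'
  exact this hv.symm

/-- In degree three, `J_{2q}` and `J_{2q+2}` differ as soon as `d ≥ 4 (q + 1)`. -/
theorem three_lt_saturationTerm {d q : ℕ} (hq : 1 ≤ q) (h : 4 * (q + 1) ≤ d) :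
    3 < saturationTerm d q := by
  set e := 2 * (d / 2) with he
  have hhom := isWeightedHomogeneous_cubicLead d (q + 1) e
  refine lt_saturationTerm hq (by omega) le_rfl (P := cubicLead d (q + 1) e)
    (isHomogeneous_of_bidegree hhom)
    (leadTransvectant_mem fun n => genQuad_mem (by omega) (by omega) le_rfl n)
    (notMem_filtrationIdeal (by omega) (cubicLead_ne_zero (by omega) h he)
      (lower_cubicLead (by omega) (by omega) (by omega)) ?_)
  intro k hk1 hkq
  refine pairing_mul_genQuad_zero hhom fun s hs => ?_
  -- A test monomial a_i would need i = e + 2(q+1-k) ≥ e + 2 > d.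
  exfalso
  have h1 := congrArg Prod.fst hs
  have h2 := congrArg Prod.snd hs
  simp only [Prod.fst_add, Prod.snd_add, weight_bidegree_fst] at h1 h2
  obtain ⟨i, rfl, hi⟩ := exists_eq_single (show s.degree = 1 by omega)
  rw [hi] at h2
  simp only at h2
  have := i.isLt
  omega

/-! ### Degree four: two independent invariants -/

/-- Meant for forms supported at a and d - a with a = 0 or 1: their quadratic covariants H_2 and H_4
live only in the first, middle and last positions. -/
lemma leadTransvectant_sparse {m : ℕ} (hm : 0 < m) {β : ℕ → ℚ}
    (h : ∀ j, 0 < j → j < 2 * m → j ≠ m → β j = 0) :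
    leadTransvectant (2 * m) (2 * m) (2 * m) β β =
      2 * ((2 * m).factorial : ℚ) * (β 0 * β (2 * m)) +
        (-1) ^ m * ((m.factorial : ℚ) * β m) ^ 2 := by
  rw [leadTransvectant, ← Finset.sum_subset (s₁ := {0, m, 2 * m})]
  · rw [Finset.sum_insert (by simp; omega), Finset.sum_pair (by omega)]
    simp only [Nat.sub_self, Nat.sub_zero, zero_add, pow_zero, Nat.factorial_zero]
    rw [show 2 * m - m = m by omega, pow_mul]
    push_cast
    norm_num
    ring
  · intro j hj
    simp at hj ⊢
    omega
  · intro j hj hj'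
    simp at hj hj'
    rw [h j (by omega) (by omega) (by omega)]
    simp

section Values

variable {m : ℕ}

lemma quadCoeff_twoPoint_of_ne {a b r n : ℕ} (h1 : a + a ≠ n + r) (h2 : a + b ≠ n + r)
    (h3 : b + b ≠ n + r) : quadCoeff (twoPoint a b) m r n = 0 := by
  rw [quadCoeff_twoPoint]
  refine Finset.sum_eq_zero fun l _ => ?_
  rw [if_neg h1, if_neg h2, if_neg (by omega), if_neg h3]
  simp

lemma quadCoeff_endpoints_two : quadCoeff (twoPoint 0 (m + 2)) m 2 m = 2 := by
  rw [quadCoeff_twoPoint]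
  simp [Finset.sum_range_succ, shiftChoose, add_comm]
  norm_num

lemma quadCoeff_endpoints_four : quadCoeff (twoPoint 0 (m + 4)) m 4 m = 2 := by
  rw [quadCoeff_twoPoint]
  simp [Finset.sum_range_succ, shiftChoose, add_comm]
  norm_num

lemma quadCoeff_inner_two_first (hm : 0 < m) :
    quadCoeff (twoPoint 1 (m + 1)) m 2 0 = -2 := by
  rw [quadCoeff_twoPoint]
  have h1 : ¬ 1 + (m + 1) = 0 + 2 := by omega
  have h2 : ¬ m + 1 + 1 = 0 + 2 := by omega
  have h3 : ¬ m + 1 + (m + 1) = 0 + 2 := by omega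
  simp only [h1, h2, h3, if_false]
  simp [Finset.sum_range_succ, shiftChoose]

lemma quadCoeff_inner_two_last (hm : 0 < m) :
    quadCoeff (twoPoint 1 (m + 1)) m 2 (2 * m) = -2 := by
  rw [quadCoeff_twoPoint]
  have h1 : ¬ 1 + 1 = 2 * m + 2 := by omega
  have h2 : ¬ 1 + (m + 1) = 2 * m + 2 := by omega
  have h3 : ¬ m + 1 + 1 = 2 * m + 2 := by omega
  have h4 : m + 1 + (m + 1) = 2 * m + 2 := by omega
  simp only [h1, h2, h3, h4, if_true, if_false]
  simp [Finset.sum_range_succ, shiftChoose]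

lemma quadCoeff_inner_two_middle (hm : 0 < m) :
    quadCoeff (twoPoint 1 (m + 1)) m 2 m = 2 * (m : ℚ) ^ 2 - 4 := by
  rw [quadCoeff_twoPoint]
  have h1 : ¬ 1 + 1 = m + 2 := by omega
  have h2 : 1 + (m + 1) = m + 2 := by omega
  have h3 : m + 1 + 1 = m + 2 := by omega
  have h4 : ¬ m + 1 + (m + 1) = m + 2 := by omega
  have h5 : m.choose (m - 1) = m := by
    obtain ⟨m, rfl⟩ : ∃ m', m = m' + 1 := ⟨m - 1, by omega⟩
    simp
  simp only [h1, h2, h3, h4, if_true, if_false]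
  simp [Finset.sum_range_succ, shiftChoose, h5]
  split_ifs <;> first | omega | ring

lemma quadCoeff_inner_four_middle (hm : 2 ≤ m) :
    quadCoeff (twoPoint 1 (m + 3)) m 4 m = 2 * (m : ℚ) ^ 2 - 8 := by
  rw [quadCoeff_twoPoint]
  have h1 : ¬ 1 + 1 = m + 4 := by omega
  have h2 : 1 + (m + 3) = m + 4 := by omega
  have h3 : m + 3 + 1 = m + 4 := by omega
  have h4 : ¬ m + 3 + (m + 3) = m + 4 := by omega
  have h5 : m.choose (m - 1) = m := by
    obtain ⟨m, rfl⟩ : ∃ m', m = m' + 1 := ⟨m - 1, by omega⟩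
    simp
  have h6 : 4 ≤ m + 3 := by omega
  simp only [h1, h2, h3, h4, if_true, if_false]
  simp [Finset.sum_range_succ, shiftChoose, h5, h6]
  ring

end Values

lemma evalTwoPoint_endpoints_quarticInvariant_one {d : ℕ} (hd : 6 ≤ d) :
    evalTwoPoint d 0 d (quarticInvariant d 1) =
      (-1) ^ d * (((d - 2).factorial : ℚ) * 2) ^ 2 := by
  obtain ⟨m, rfl⟩ : ∃ m, d = m + 2 := ⟨d - 2, by omega⟩
  rw [evalTwoPoint_quarticInvariant (by omega) le_rfl]
  simp only [mul_one, Nat.add_sub_cancel]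
  rw [leadTransvectant_sparse (by omega), quadCoeff_twoPoint_of_ne (n := 0) (by omega) (by omega)
    (by omega), quadCoeff_endpoints_two]
  · ring
  · intro j h1 h2 h3
    exact quadCoeff_twoPoint_of_ne (by omega) (by omega) (by omega)

lemma evalTwoPoint_endpoints_quarticInvariant_two {d : ℕ} (hd : 6 ≤ d) :
    evalTwoPoint d 0 d (quarticInvariant d 2) =
      (-1) ^ d * (((d - 4).factorial : ℚ) * 2) ^ 2 := by
  obtain ⟨m, rfl⟩ : ∃ m, d = m + 4 := ⟨d - 4, by omega⟩
  rw [evalTwoPoint_quarticInvariant (by omega) le_rfl]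
  simp only [Nat.reduceMul, Nat.add_sub_cancel]
  rw [leadTransvectant_sparse (by omega), quadCoeff_twoPoint_of_ne (n := 0) (by omega) (by omega)
    (by omega), quadCoeff_endpoints_four]
  · ring
  · intro j h1 h2 h3
    exact quadCoeff_twoPoint_of_ne (by omega) (by omega) (by omega)

lemma evalTwoPoint_inner_quarticInvariant_one {d : ℕ} (hd : 6 ≤ d) :
    evalTwoPoint d 1 (d - 1) (quarticInvariant d 1) = 8 * ((2 * (d - 2)).factorial : ℚ) +
      (-1) ^ d * (((d - 2).factorial : ℚ) * (2 * ((d - 2 : ℕ) : ℚ) ^ 2 - 4)) ^ 2 := by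
  obtain ⟨m, rfl⟩ : ∃ m, d = m + 2 := ⟨d - 2, by omega⟩
  rw [evalTwoPoint_quarticInvariant (by omega) (by omega)]
  simp only [mul_one, Nat.add_sub_cancel, show m + 2 - 1 = m + 1 by omega]
  rw [leadTransvectant_sparse (by omega), quadCoeff_inner_two_first (by omega),
    quadCoeff_inner_two_last (by omega), quadCoeff_inner_two_middle (by omega)]
  · ring
  · intro j h1 h2 h3
    exact quadCoeff_twoPoint_of_ne (by omega) (by omega) (by omega)

lemma evalTwoPoint_inner_quarticInvariant_two {d : ℕ} (hd : 6 ≤ d) :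
    evalTwoPoint d 1 (d - 1) (quarticInvariant d 2) =
      (-1) ^ d * (((d - 4).factorial : ℚ) * (2 * ((d - 4 : ℕ) : ℚ) ^ 2 - 8)) ^ 2 := by
  obtain ⟨m, rfl⟩ : ∃ m, d = m + 4 := ⟨d - 4, by omega⟩
  rw [evalTwoPoint_quarticInvariant (by omega) (by omega)]
  simp only [Nat.reduceMul, Nat.add_sub_cancel, show m + 4 - 1 = m + 3 by omega]
  rw [leadTransvectant_sparse (by omega), quadCoeff_twoPoint_of_ne (n := 0) (by omega) (by omega)
    (by omega), quadCoeff_inner_four_middle (by omega)]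
  · ring
  · intro j h1 h2 h3
    exact quadCoeff_twoPoint_of_ne (by omega) (by omega) (by omega)

/-- With m = n + 7 the left side is m(4m-2)(2m²-4m-2). Combined with 4^m < m C(2m,m), it makes the
central binomial coefficient dominate the polynomial in the determinant of the two invariants. -/
lemma polynomial_lt_four_pow (n : ℕ) :
    (n + 7) * ((4 * n + 26) * (2 * n ^ 2 + 24 * n + 68)) < 2 * 4 ^ (n + 7) := by
  induction n with
  | zero => norm_num
  | succ n ih =>
    have h : 4 * ((n + 7) * ((4 * n + 26) * (2 * n ^ 2 + 24 * n + 68))) =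
        (n + 1 + 7) * ((4 * (n + 1) + 26) * (2 * (n + 1) ^ 2 + 24 * (n + 1) + 68)) +
          (24 * n ^ 4 + 580 * n ^ 3 + 5136 * n ^ 2 + 19612 * n + 26944) := by ring
    calc _ ≤ 4 * ((n + 7) * ((4 * n + 26) * (2 * n ^ 2 + 24 * n + 68))) :=
          h ▸ Nat.le_add_right _ _
      _ < 4 * (2 * 4 ^ (n + 7)) := Nat.mul_lt_mul_of_pos_left ih (by norm_num)
      _ = 2 * 4 ^ (n + 1 + 7) := by ring

/-- The two quartic invariants are linearly independent. -/
lemma quarticInvariant_det_ne_zero {d : ℕ} (hd : 6 ≤ d) (h7 : d ≠ 7) :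
    evalTwoPoint d 0 d (quarticInvariant d 1) *
        evalTwoPoint d 1 (d - 1) (quarticInvariant d 2) -
      evalTwoPoint d 1 (d - 1) (quarticInvariant d 1) *
        evalTwoPoint d 0 d (quarticInvariant d 2) ≠ 0 := by
  rw [evalTwoPoint_endpoints_quarticInvariant_one hd,
    evalTwoPoint_endpoints_quarticInvariant_two hd,
    evalTwoPoint_inner_quarticInvariant_one hd, evalTwoPoint_inner_quarticInvariant_two hd]
  obtain ⟨m, rfl⟩ : ∃ m, d = m + 2 := ⟨d - 2, by omega⟩
  simp only [Nat.add_sub_cancel, show m + 2 - 4 = m - 2 by omega]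
  have hf : ((2 * m).factorial : ℚ) = (m.factorial : ℚ) ^ 2 * m.centralBinom := by
    have := Nat.choose_mul_factorial_mul_factorial (show m ≤ 2 * m by omega)
    rw [show 2 * m - m = m by omega] at this
    rw [← this, Nat.centralBinom]; push_cast; ring
  have hm2 : ((m - 2 : ℕ) : ℚ) = m - 2 := by rw [Nat.cast_sub (by omega)]; norm_num
  have h1 : (m.factorial : ℚ) ≠ 0 := by exact_mod_cast m.factorial_ne_zero
  have h2 : ((m - 2).factorial : ℚ) ≠ 0 := by exact_mod_cast (m - 2).factorial_ne_zero
  have hε : ((-1 : ℚ) ^ (m + 2)) * (-1) ^ (m + 2) = 1 := by rw [← mul_pow]; simp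
  -- Up to a nonzero factor this is the determinant. For even d both terms are positive; for odd d
  -- they have opposite signs, and for d = 7, that is m = 5, they cancel: 504 - 504.
  have hmain : (4 * (m : ℚ) - 2) * (2 * (m : ℚ) ^ 2 - 4 * m - 2) +
      2 * (-1) ^ (m + 2) * m.centralBinom ≠ 0 := by
    have hm4 : (4 : ℚ) ≤ m := by exact_mod_cast (show 4 ≤ m by omega)
    have hc : (0 : ℚ) < m.centralBinom := by exact_mod_cast Nat.centralBinom_pos m
    have hp : (0 : ℚ) < (4 * (m : ℚ) - 2) * (2 * (m : ℚ) ^ 2 - 4 * m - 2) := by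
      apply mul_pos <;> nlinarith
    rcases Nat.even_or_odd (m + 2) with hev | hodd
    · rw [hev.neg_one_pow]
      positivity
    · rw [hodd.neg_one_pow]
      obtain ⟨n, rfl⟩ : ∃ n, m = n + 7 := ⟨m - 7, by
        rcases hodd with ⟨c, hc⟩; omega⟩
      have hq := polynomial_lt_four_pow n
      have h4 := Nat.four_pow_lt_mul_centralBinom (n + 7) (by omega)
      have h5 : (n + 7) * ((4 * n + 26) * (2 * n ^ 2 + 24 * n + 68)) <
          (n + 7) * (2 * (n + 7).centralBinom) := by
        rw [mul_left_comm _ 2]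
        exact hq.trans (Nat.mul_lt_mul_of_pos_left h4 (by norm_num))
      have h6 := Nat.lt_of_mul_lt_mul_left h5
      have h7 : ((4 * n + 26) * (2 * n ^ 2 + 24 * n + 68) : ℚ) < 2 * (n + 7).centralBinom := by
        exact_mod_cast h6
      refine ne_of_lt ?_
      have h8 : (4 * ((n + 7 : ℕ) : ℚ) - 2) *
          (2 * ((n + 7 : ℕ) : ℚ) ^ 2 - 4 * ((n + 7 : ℕ) : ℚ) - 2) =
          (4 * n + 26) * (2 * n ^ 2 + 24 * n + 68) := by push_cast; ring
      rw [h8]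
      linarith
  intro hzero
  rw [hf, hm2] at hzero
  have : -(16 * (m.factorial : ℚ) ^ 2 * ((m - 2).factorial : ℚ) ^ 2) *
      ((4 * (m : ℚ) - 2) * (2 * (m : ℚ) ^ 2 - 4 * m - 2) +
        2 * (-1) ^ (m + 2) * m.centralBinom) = 0 := by
    rw [← hzero]
    generalize (-1 : ℚ) ^ (m + 2) = ε at hε ⊢
    linear_combination (16 * (m.factorial : ℚ) ^ 2 * ((m - 2).factorial : ℚ) ^ 2 *
      ((4 * (m : ℚ) - 2) * (2 * (m : ℚ) ^ 2 - 4 * m - 2))) * hε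
  exact mul_ne_zero (neg_ne_zero.mpr (by positivity)) hmain this

/-- In degree four, `J_2` and `J_4` differ for `d ≥ 6`, `d ≠ 7`. -/
theorem four_lt_saturationTerm_one {d : ℕ} (hd : 6 ≤ d) (h7 : d ≠ 7) :
    4 < saturationTerm d 1 := by
  have hk1 : 2 * 1 ≤ d := by omega
  have hk2 : 2 * 2 ≤ d := by omega
  -- One linear condition is imposed on the span of the two invariants: orthogonality to a_d a_{d-2}
  -- times the first coefficient of H_2.
  obtain ⟨x, y, hf, hne⟩ := exists_combination_ne_zero
    ((pairing (invChoose d)).flip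
    (genCoeff d d * genCoeff d (d - 2) * genQuad d 2 0))
    (evalTwoPoint d 0 d)
    (evalTwoPoint d 1 (d - 1))
    (quarticInvariant d 1) (quarticInvariant d 2) (quarticInvariant_det_ne_zero hd h7)
  rw [LinearMap.flip_apply] at hf
  set P := x • quarticInvariant d 1 + y • quarticInvariant d 2 with hP
  have hf' : pairing (invChoose d) P (genCoeff d d * genCoeff d (d - 2) * genQuad d 2 0) = 0 := hf
  have hhom : IsWeightedHomogeneous (bidegree d) P (4, 2 * d) := by
    rw [hP, smul_eq_C_mul, smul_eq_C_mul]
    exact ((isWeightedHomogeneous_quarticInvariant hk1).C_mul x).add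
      ((isWeightedHomogeneous_quarticInvariant hk2).C_mul y)
  have hlower : lower d P = 0 := by
    rw [hP, map_add, Derivation.map_smul, Derivation.map_smul, lower_quarticInvariant hk1,
      lower_quarticInvariant hk2]
    simp
  have hraise : raise d P = 0 := by
    rw [hP, map_add, Derivation.map_smul, Derivation.map_smul, raise_quarticInvariant hk1,
      raise_quarticInvariant hk2]
    simp
  have hmem : P ∈ filtrationIdeal d (1 + 1) := by
    refine Ideal.add_mem _ (Submodule.smul_of_tower_mem _ x (leadTransvectant_mem fun n => ?_))
      (Submodule.smul_of_tower_mem _ y (leadTransvectant_mem fun n => ?_))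
    · exact genQuad_mem (by omega) le_rfl (by norm_num) n
    · exact genQuad_mem (by omega) (by norm_num) le_rfl n
  -- Since `raise` kills P, P is orthogonal to the image of `lower`. Lowering a_d a_{d-1} H_2 gives
  -- a relation between the two tests, so the second follows from the first.
  have hf2 : pairing (invChoose d) P
      (genCoeff d (d - 1) * genCoeff d (d - 1) * genQuad d 2 0) = 0 := by
    have h0 : pairing (invChoose d) P
        (lower d (genCoeff d d * genCoeff d (d - 1) * genQuad d 2 0)) = 0 := by
      rw [pairing_lower, hraise]; simp
    rw [Derivation.leibniz, lower_genQuad_zero hk1, Derivation.leibniz, lower_genCoeff le_rfl,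
      lower_genCoeff (by omega), show d - 1 - 1 = d - 2 by omega] at h0
    have e : (genCoeff d d * genCoeff d (d - 1)) • (0 : CoeffRing d) + genQuad d 2 0 •
        (genCoeff d d • (((d - 1 : ℕ) : CoeffRing d) * genCoeff d (d - 2)) +
          genCoeff d (d - 1) • ((d : CoeffRing d) * genCoeff d (d - 1))) =
        ((d - 1 : ℕ) : ℚ) • (genCoeff d d * genCoeff d (d - 2) * genQuad d 2 0) +
          ((d : ℕ) : ℚ) • (genCoeff d (d - 1) * genCoeff d (d - 1) * genQuad d 2 0) := by
      simp only [Algebra.smul_def, map_natCast, Algebra.algebraMap_self, RingHom.id_apply]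
      ring
    rw [e, map_add, map_smul, map_smul, hf', smul_zero, zero_add, smul_eq_mul] at h0
    have hd0 : (d : ℚ) ≠ 0 := by
      have : d ≠ 0 := by omega
      exact_mod_cast this
    exact (mul_eq_zero.mp h0).resolve_left hd0
  refine lt_saturationTerm le_rfl (by omega) le_rfl (isHomogeneous_of_bidegree hhom) hmem
    (notMem_filtrationIdeal hk1 hne hlower ?_)
  intro k hk hk'
  obtain rfl : k = 1 := by omega
  refine pairing_mul_genQuad_zero hhom fun s hs => ?_
  have h1 := congrArg Prod.fst hs
  have h2 := congrArg Prod.snd hs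
  simp only [Prod.fst_add, Prod.snd_add, weight_bidegree_fst] at h1 h2
  obtain ⟨i, j, rfl, hij⟩ := exists_eq_single_add_single (show s.degree = 2 by omega)
  rw [hij] at h2
  simp only at h2
  have hmon : (monomial (Finsupp.single i 1 + Finsupp.single j 1) 1 : CoeffRing d) =
      genCoeff d i * genCoeff d j := by
    rw [genCoeff_val, genCoeff_val, X, X, monomial_mul, one_mul]
  have hi := i.isLt
  have hj := j.isLt
  rw [hmon]
  -- The test monomials a_i a_j have weight 2d - 2.
  have hcases : ((i : ℕ) = d ∧ (j : ℕ) = d - 2) ∨ ((i : ℕ) = d - 1 ∧ (j : ℕ) = d - 1) ∨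
      ((i : ℕ) = d - 2 ∧ (j : ℕ) = d) := by omega
  rcases hcases with ⟨h3, h4⟩ | ⟨h3, h4⟩ | ⟨h3, h4⟩
  · rw [h3, h4]; exact hf'
  · rw [h3, h4]; exact hf2
  · rw [h3, h4, mul_comm (genCoeff d (d - 2))]; exact hf'

/-! ### Degree three for d = 7 -/

/-- Both cubics have degree 3 and weight 6, so the two evaluations read off their coefficients at
a_0² a_6 and a_2³. -/
lemma cubicLead_det_ne_zero :
    evalTwoPoint 7 0 6 (cubicLead 7 1 4) * evalTwoPoint 7 2 7 (cubicLead 7 2 2) -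
      evalTwoPoint 7 2 7 (cubicLead 7 1 4) * evalTwoPoint 7 0 6 (cubicLead 7 2 2) ≠ 0 := by
  rw [evalTwoPoint_cubicLead (by norm_num) (by norm_num),
    evalTwoPoint_cubicLead (by norm_num) (by norm_num),
    evalTwoPoint_cubicLead (by norm_num) (by norm_num),
    evalTwoPoint_cubicLead (by norm_num) (by norm_num)]
  simp [leadTransvectant, quadCoeff_twoPoint, Finset.sum_range_succ, twoPoint, shiftChoose,
    Nat.choose, Nat.factorial]
  norm_num

/-- In degree three, `J_2` and `J_4` differ for `d = 7`. -/
theorem three_lt_saturationTerm_seven : 3 < saturationTerm 7 1 := by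
  -- In weight 6 the only multiple of the first coefficient of H_2 to test is the one by a_4, so a
  -- single linear condition is imposed on a two-dimensional space.
  obtain ⟨x, y, hf, hne⟩ := exists_combination_ne_zero
    ((pairing (invChoose 7)).flip (genCoeff 7 4 * genQuad 7 2 0))
    (evalTwoPoint 7 0 6)
    (evalTwoPoint 7 2 7)
    (cubicLead 7 1 4) (cubicLead 7 2 2) cubicLead_det_ne_zero
  rw [LinearMap.flip_apply] at hf
  set P := x • cubicLead 7 1 4 + y • cubicLead 7 2 2 with hP
  have hf' : pairing (invChoose 7) P (genCoeff 7 4 * genQuad 7 2 0) = 0 := hf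
  have hhom : IsWeightedHomogeneous (bidegree 7) P (3, 6) := by
    rw [hP, smul_eq_C_mul, smul_eq_C_mul]
    exact ((isWeightedHomogeneous_cubicLead 7 1 4).C_mul x).add
      ((isWeightedHomogeneous_cubicLead 7 2 2).C_mul y)
  have hlower : lower 7 P = 0 := by
    rw [hP, map_add, Derivation.map_smul, Derivation.map_smul,
      lower_cubicLead (by norm_num) (by norm_num) (by norm_num),
      lower_cubicLead (by norm_num) (by norm_num) (by norm_num)]
    simp
  have hmem : P ∈ filtrationIdeal 7 (1 + 1) := by
    refine Ideal.add_mem _ (Submodule.smul_of_tower_mem _ x (leadTransvectant_mem fun n => ?_))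
      (Submodule.smul_of_tower_mem _ y (leadTransvectant_mem fun n => ?_))
    · exact genQuad_mem (by norm_num) le_rfl (by norm_num) n
    · exact genQuad_mem (by norm_num) (by norm_num) le_rfl n
  refine lt_saturationTerm le_rfl (by norm_num) le_rfl (isHomogeneous_of_bidegree hhom) hmem
    (notMem_filtrationIdeal (by norm_num) hne hlower ?_)
  intro k hk hk'
  obtain rfl : k = 1 := by omega
  refine pairing_mul_genQuad_zero hhom fun s hs => ?_
  have h1 := congrArg Prod.fst hs
  have h2 := congrArg Prod.snd hs
  simp only [Prod.fst_add, Prod.snd_add, weight_bidegree_fst] at h1 h2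
  obtain ⟨i, rfl, hi⟩ := exists_eq_single (show s.degree = 1 by omega)
  rw [hi] at h2
  simp only at h2
  have hi4 : (i : ℕ) = 4 := by omega
  have hmon : (monomial (Finsupp.single i 1) 1 : CoeffRing 7) = genCoeff 7 4 := by
    rw [← hi4, genCoeff_val, X]
  rw [hmon]
  exact hf'

end RNC

end

theorem theorem2 :
    ∀ q b N : ℕ,
      (q, b, N) ∈ ({(1, 3, 6), (1, 4, 8), (2, 3, 12), (3, 3, 16)} : Set (ℕ × ℕ × ℕ)) →
        ∀ d : ℕ, N ≤ d → b < RNC.saturationTerm d q := by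
  intro q b N h d hd
  simp only [Set.mem_insert_iff, Set.mem_singleton_iff, Prod.mk.injEq] at h
  rcases h with ⟨rfl, rfl, rfl⟩ | ⟨rfl, rfl, rfl⟩ | ⟨rfl, rfl, rfl⟩ | ⟨rfl, rfl, rfl⟩
  -- For d = 7 the two quartic invariants do not serve, and 7 < 8 puts it out of reach of the
  -- general cubic argument.
  · rcases eq_or_ne d 7 with rfl | h7
    · exact RNC.three_lt_saturationTerm_seven
    · exact lt_trans (by norm_num) (RNC.four_lt_saturationTerm_one hd h7)
  · exact RNC.four_lt_saturationTerm_one (by omega) (by omega)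
  · exact RNC.three_lt_saturationTerm (by norm_num) hd
  · exact RNC.three_lt_saturationTerm (by norm_num) hd
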